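/- Let $(R,\mathfrak m,k)$ be a Noetherian local ring of prime characteristic $p$, and write $q=p^n$ for $n\ge 0$. For an ideal $K\subseteq R$ let $K^{[q]}$ be the ideal generated by the $q$-th powers of the elements of $K$. Let ${}^{f^n}\!R$ be $R$ regarded as an $R$-module via $f^n\colon R\to R$, $r\mapsto r^{q}$, and let $\operatorname{Tor}_i^R(-,{}^{f^n}\!R)$ be the left derived functors of the base change functor $F^n=-\otimes_R{}^{f^n}\!R$ from $R$-modules to $R$-modules, where the values carry the $R$-module structure coming from the target copy of $R$. Let $\lambda$ denote length over $R$. Let $I$ and $\mathfrak a$ be $\mathfrak m$-primary ideals. Suppose that $I=J+uR$ for some $u\in R$, where $J$ is an ideal of finite projective dimension such that $R/J^{[q]}$ is an Artinian Gorenstein ring for all sufficiently large $q$. Consider the following functions of $n$: 1. $\lambda\big(\operatorname{Hom}_R(R/\mathfrak a,\,R/I^{[q]})\big)$; 2. $\lambda\big(\operatorname{Tor}_1^R(R/I,{}^{f^n}\!R)\otimes_R R/\mathfrak a\big)$; 3. $\lambda\big(\operatorname{Tor}_2^R(R/I^{[q]},R/\mathfrak a)\big)$. All three take finite values, and the difference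 of any two of them is bounded as a function of $n$. In particular (the case $\mathfrak a=\mathfrak m$), the difference between the length of the socle $(0:_{R/I^{[q]}}\mathfrak m)$ and the second Betti number of $R/I^{[q]}$, i.e. the rank of $F_2$ in a minimal free resolution $\cdots\to F_2\to F_1\to F_0\to R/I^{[q]}\to 0$ over $R$, is bounded as a function of $n$. -/

import Mathlib

open CategoryTheory
open scoped TensorProduct

universe u

noncomputable section

/-- The Frobenius power `I^[q]`, `q = p ^ n`: the ideal generated by the `q`-th powers of the
elements (equivalently, of any set of generators, see `frobPower_span`) of `I`. -/
def frobPower {R : Type u} [CommRing R] (p : ℕ) [ExpChar R p] (I : Ideal R) (n : ℕ) : Ideal R :=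
  Ideal.span ((fun x : R => x ^ p ^ n) '' (I : Set R))

/-- The Frobenius power is the extension of `I` along the `n`-th iterate of Frobenius. -/
theorem frobPower_eq_map {R : Type u} [CommRing R] (p : ℕ) [ExpChar R p] (I : Ideal R) (n : ℕ) :
    frobPower p I n = I.map (iterateFrobenius R p n) := rfl

/-- The Frobenius power is generated by the `q`-th powers of any set of generators. -/
theorem frobPower_span {R : Type u} [CommRing R] (p : ℕ) [ExpChar R p] (S : Set R) (n : ℕ) :
    frobPower p (Ideal.span S) n = Ideal.span ((fun x : R => x ^ p ^ n) '' S) := by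
  rw [frobPower_eq_map, Ideal.map_span]
  rfl

/-- The functor `F^n` from `R`-modules to `R`-modules: base change along the `n`-th iterate
`f^n : R → R`, `r ↦ r ^ (p ^ n)`, of the Frobenius endomorphism; on objects `M ↦ M ⊗ ^{f^n}R`,
with the `R`-module structure coming from the target copy of `R`. -/
abbrev frobFunctor (R : Type u) [CommRing R] (p : ℕ) [ExpChar R p] (n : ℕ) :
    ModuleCat.{u} R ⥤ ModuleCat.{u} R :=
  ModuleCat.extendScalars.{u, u, u} (iterateFrobenius R p n)

instance frobFunctor_additive (R : Type u) [CommRing R] (p : ℕ) [ExpChar R p] (n : ℕ) :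
    (frobFunctor R p n).Additive :=
  (ModuleCat.extendRestrictScalarsAdj.{u, u, u}
    (iterateFrobenius R p n)).left_adjoint_additive

/-- `Tor_i^R(M, ^{f^n}R)`, i.e. the `i`-th left derived functor of `F^n` applied to `M`, with
its `R`-module structure coming from the target copy of `R`. -/
abbrev frobTor (R : Type u) [CommRing R] (p : ℕ) [ExpChar R p] (n i : ℕ)
    (M : Type u) [AddCommGroup M] [Module R M] : ModuleCat.{u} R :=
  ((frobFunctor R p n).leftDerived i).obj (ModuleCat.of R M)

/-- `Tor_i^R(M, N)`. -/
abbrev torModule (R : Type u) [CommRing R] (i : ℕ) (M N : Type u)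
    [AddCommGroup M] [Module R M] [AddCommGroup N] [Module R N] : ModuleCat.{u} R :=
  ((Tor (ModuleCat.{u} R) i).obj (ModuleCat.of R M)).obj (ModuleCat.of R N)

/-- A Gorenstein local ring: a Noetherian local ring of finite injective dimension as a module
over itself. -/
def IsGorensteinLocal (A : Type u) [CommRing A] : Prop :=
  IsLocalRing A ∧ IsNoetherianRing A ∧ injectiveDimension (ModuleCat.of A A) ≠ ⊤

/-- The socle `(0 :_M 𝔪)` of a module over a local ring. -/
def socle (R : Type u) [CommRing R] [IsLocalRing R] (M : Type u) [AddCommGroup M] [Module R M] :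
    Submodule R M :=
  Submodule.torsionBySet R M (IsLocalRing.maximalIdeal R : Set R)

/-- The data `⋯ → R^{b 2} → R^{b 1} → R^{b 0} → M → 0` (with differentials `d` and augmentation
`ε`) form a minimal free resolution of `M` over the local ring `R`. -/
structure IsMinimalFreeResolution (R : Type u) [CommRing R] [IsLocalRing R]
    (M : Type u) [AddCommGroup M] [Module R M] (b : ℕ → ℕ)
    (d : ∀ i, (Fin (b (i + 1)) → R) →ₗ[R] (Fin (b i) → R))
    (ε : (Fin (b 0) → R) →ₗ[R] M) : Prop where
  surjective : Function.Surjective ε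
  exact_zero : Function.Exact (d 0) ε
  exact_succ : ∀ i, Function.Exact (d (i + 1)) (d i)
  minimal : ∀ i, LinearMap.range (d i) ≤
    IsLocalRing.maximalIdeal R • (⊤ : Submodule R (Fin (b i) → R))

/-- The `i`-th Betti number of `M`: the rank of the `i`-th module in a minimal free resolution
of `M`. (For `R` Noetherian local and `M` finitely generated such a resolution exists and the rank
does not depend on it, so the set below is a singleton.) -/
def bettiNumber (R : Type u) [CommRing R] [IsLocalRing R]
    (M : Type u) [AddCommGroup M] [Module R M] (i : ℕ) : ℕ :=
  sInf {r | ∃ b d ε, IsMinimalFreeResolution R M b d ε ∧ r = b i}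

/-- Two length functions take finite values only and their difference is bounded. -/
def BoundedDifference (g h : ℕ → ℕ∞) : Prop :=
  (∀ n, g n ≠ ⊤) ∧ (∀ n, h n ≠ ⊤) ∧ ∃ C : ℕ, ∀ n, g n ≤ h n + C ∧ h n ≤ g n + C

end

/-! Write `q = p ^ n` and let `g_1, …, g_m` generate `J`. All three functions are compared with one
quantity, `κ(n)`, the length of `(J^[q] : x^q) ⊗ R/a`.

The uniformity in `n` comes from the finite projective dimension of `J`. A finite minimal resolution
of `R/J` stays exact after its matrices are raised entrywise to `q`-th powers. Indeed the length of
the resolution is at most the depth (`extVanishes_of_minimal_exact`), the twisted homology is killed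
by `J^[q]` and hence by a power of the maximal ideal, and the acyclicity lemma
(`exact_of_extVanishes`) applies. So every `J^[q]` is presented by the same numbers `m` of
generators and `l` of relations (`exists_presentation_of_projectiveDimension_ne_top`), and the
lengths of `J^[q] ⊗ R/a` and `Tor_1(J^[q], R/a)` are bounded.

Hom: for large `q` the ring `D = R/J^[q]` is self-injective, so `Hom(-, D)` preserves length, and
`D/x^q D` is the dual of `(0 :_D x^q)`. By adjunction `Hom(R/a, D/x^q D)` has the length of `(0 :_D
x^q) ⊗ R/a` (`length_hom_quotient_sup_span`), and `(0 :_D x^q) = (J^[q] : x^q)/J^[q]`.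

Frobenius Tor: `Tor_1(R/I, ^{f^n}R)` is the module of relations of `x^q, g_j^q` modulo the twisted
relations of `x, g_j`. The `x`-coordinate maps relations onto `(J^[q] : x^q)`, and its kernel
already consists of twisted relations. Hence this Tor is a quotient of the colon ideal by a number
of elements independent of `n` (`exists_frobTor_colon_bounds`).

`Tor_2`: use the long exact sequence of `0 → R/(J^[q] : x^q) → R/J^[q] → R/I^[q] → 0`
(`length_torModule_two_sup_le`, `length_colon_tensor_le`).

For `a` the maximal ideal, `Hom(k, M)` is the socle and the length of `Tor_2(M, k)` is the second
Betti number. -/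

noncomputable section

/-! ### Minimal free resolutions over a local ring. -/

section FreeResolutions

open IsLocalRing

/-- A resolution of `M` by finite free modules, not necessarily minimal. -/
structure IsFreeResolution (R : Type u) [CommRing R] (M : Type u) [AddCommGroup M] [Module R M]
    (b : ℕ → ℕ) (d : ∀ i, (Fin (b (i + 1)) → R) →ₗ[R] (Fin (b i) → R))
    (ε : (Fin (b 0) → R) →ₗ[R] M) : Prop where
  surjective : Function.Surjective ε
  exact_zero : Function.Exact (d 0) ε
  exact_succ : ∀ i, Function.Exact (d (i + 1)) (d i)

theorem mem_ideal_smul_top_pi_iff {R : Type u} [CommRing R] (I : Ideal R) {n : ℕ}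
    (v : Fin n → R) : v ∈ I • (⊤ : Submodule R (Fin n → R)) ↔ ∀ i, v i ∈ I := by
  constructor
  · intro hv i
    have h := Submodule.mem_map_of_mem (f := (LinearMap.proj i : (Fin n → R) →ₗ[R] R)) hv
    rw [Submodule.map_smul''] at h
    exact (Ideal.mul_le_left : I * _ ≤ I) h
  · intro h
    rw [pi_eq_sum_univ' v]
    exact Submodule.sum_mem _ fun i _ => Submodule.smul_mem_smul (h i) trivial

/-- A finitely generated module over a local ring has a minimal free cover. -/
theorem exists_minimal_cover (R : Type u) [CommRing R] [IsLocalRing R]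
    (M : Type u) [AddCommGroup M] [Module R M] [Module.Finite R M] :
    ∃ (n : ℕ) (φ : (Fin n → R) →ₗ[R] M), Function.Surjective φ ∧
      LinearMap.ker φ ≤ maximalIdeal R • (⊤ : Submodule R (Fin n → R)) := by
  -- Lifts of a basis of `k ⊗ M` generate `M` by Nakayama. A relation between them reduces to one
  -- between basis vectors, so its coefficients lie in the maximal ideal.
  let B := Module.finBasis (ResidueField R) (ResidueField R ⊗[R] M)
  have hs : Function.Surjective (TensorProduct.mk R (ResidueField R) M 1) :=
    TensorProduct.mk_surjective R M (ResidueField R) residue_surjective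
  choose f hf using fun i => hs (B i)
  refine ⟨_, Fintype.linearCombination R f, ?_, ?_⟩
  · rw [← LinearMap.range_eq_top, Fintype.range_linearCombination]
    exact span_eq_top_of_tmul_eq_basis f B hf
  · intro v hv
    rw [mem_ideal_smul_top_pi_iff]
    intro i
    have h0 : ∑ j, residue R (v j) • B j = 0 := by
      have := congrArg (TensorProduct.mk R (ResidueField R) M 1) (LinearMap.mem_ker.mp hv)
      rw [Fintype.linearCombination_apply, map_sum, map_zero] at this
      rw [← this]
      refine Finset.sum_congr rfl fun j _ => ?_
      rw [map_smul, hf]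
      exact algebraMap_smul (ResidueField R) (v j) (B j)
    have := Fintype.linearIndependent_iff.mp B.linearIndependent _ h0 i
    exact (residue_eq_zero_iff _).mp this

section Construction

variable {R : Type u} [CommRing R] [IsLocalRing R] [IsNoetherianRing R]

/-- A choice of a minimal cover of a submodule of a finite free module. -/
theorem exists_minimal_cover_submodule {n : ℕ} (Z : Submodule R (Fin n → R)) :
    ∃ (m : ℕ) (φ : (Fin m → R) →ₗ[R] (Fin n → R)), LinearMap.range φ = Z ∧
      LinearMap.ker φ ≤ maximalIdeal R • (⊤ : Submodule R (Fin m → R)) := by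
  obtain ⟨m, φ, hφ, hk⟩ := exists_minimal_cover R Z
  refine ⟨m, Z.subtype ∘ₗ φ, ?_, ?_⟩
  · rw [LinearMap.range_comp, LinearMap.range_eq_top.mpr hφ, Submodule.map_top,
      Submodule.range_subtype]
  · rwa [LinearMap.ker_comp_of_ker_eq_bot _ Z.ker_subtype]

/-- The successive syzygies, starting from a submodule of a finite free module. -/
def syzygySeq {n : ℕ} (Z : Submodule R (Fin n → R)) : ℕ → Σ m : ℕ, Submodule R (Fin m → R)
  | 0 => ⟨n, Z⟩
  | i + 1 => ⟨_, LinearMap.ker (exists_minimal_cover_submodule (syzygySeq Z i).2).choose_spec.choose⟩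

/-- The differentials of the minimal free resolution built by `syzygySeq`. -/
def syzygyDiff {n : ℕ} (Z : Submodule R (Fin n → R)) (i : ℕ) :
    (Fin (syzygySeq Z (i + 1)).1 → R) →ₗ[R] (Fin (syzygySeq Z i).1 → R) :=
  (exists_minimal_cover_submodule (syzygySeq Z i).2).choose_spec.choose

theorem range_syzygyDiff {n : ℕ} (Z : Submodule R (Fin n → R)) (i : ℕ) :
    LinearMap.range (syzygyDiff Z i) = (syzygySeq Z i).2 :=
  (exists_minimal_cover_submodule (syzygySeq Z i).2).choose_spec.choose_spec.1

theorem ker_syzygyDiff {n : ℕ} (Z : Submodule R (Fin n → R)) (i : ℕ) :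
    LinearMap.ker (syzygyDiff Z i) ≤ maximalIdeal R • ⊤ :=
  (exists_minimal_cover_submodule (syzygySeq Z i).2).choose_spec.choose_spec.2

theorem exact_syzygyDiff {n : ℕ} (Z : Submodule R (Fin n → R)) (i : ℕ) :
    Function.Exact (syzygyDiff Z (i + 1)) (syzygyDiff Z i) := by
  rw [LinearMap.exact_iff, range_syzygyDiff]
  rfl

theorem exists_isMinimalFreeResolution (M : Type u) [AddCommGroup M] [Module R M]
    [Module.Finite R M] : ∃ b d ε, IsMinimalFreeResolution R M b d ε := by
  obtain ⟨n, φ, hφ, hk⟩ := exists_minimal_cover R M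
  refine ⟨fun i => (syzygySeq (LinearMap.ker φ) i).1, syzygyDiff (LinearMap.ker φ), φ, hφ, ?_,
    exact_syzygyDiff _, ?_⟩
  · exact LinearMap.exact_iff.mpr (range_syzygyDiff (LinearMap.ker φ) 0).symm
  · rintro (_ | i)
    · rw [range_syzygyDiff]
      exact hk
    · rw [← LinearMap.exact_iff.mp (exact_syzygyDiff (LinearMap.ker φ) i)]
      exact ker_syzygyDiff _ _

end Construction

section Splice

variable {R : Type u} [CommRing R] {M : Type u} [AddCommGroup M] [Module R M]

theorem IsMinimalFreeResolution.isFreeResolution [IsLocalRing R] {b : ℕ → ℕ}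
    {d : ∀ i, (Fin (b (i + 1)) → R) →ₗ[R] (Fin (b i) → R)} {ε : (Fin (b 0) → R) →ₗ[R] M}
    (h : IsMinimalFreeResolution R M b d ε) : IsFreeResolution R M b d ε :=
  ⟨h.surjective, h.exact_zero, h.exact_succ⟩

/-- The ranks of a resolution extended by one step. -/
def consRank (b₀ : ℕ) (b : ℕ → ℕ) : ℕ → ℕ
  | 0 => b₀
  | i + 1 => b i

/-- The differentials of a resolution extended by one step. -/
def consDiff {b₀ : ℕ} {b : ℕ → ℕ} (d₀ : (Fin (b 0) → R) →ₗ[R] (Fin b₀ → R))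
    (d : ∀ i, (Fin (b (i + 1)) → R) →ₗ[R] (Fin (b i) → R)) :
    ∀ i, (Fin (consRank b₀ b (i + 1)) → R) →ₗ[R] (Fin (consRank b₀ b i) → R)
  | 0 => d₀
  | i + 1 => d i

/-- Splicing a free resolution of the kernel of a cover onto the cover. -/
theorem IsFreeResolution.cons {b₀ : ℕ} {φ : (Fin b₀ → R) →ₗ[R] M} (hφ : Function.Surjective φ)
    {b : ℕ → ℕ} {d : ∀ i, (Fin (b (i + 1)) → R) →ₗ[R] (Fin (b i) → R)}
    {ε : (Fin (b 0) → R) →ₗ[R] LinearMap.ker φ}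
    (h : IsFreeResolution R (LinearMap.ker φ) b d ε) :
    IsFreeResolution R M (consRank b₀ b)
      (consDiff ((LinearMap.ker φ).subtype ∘ₗ ε) d) φ where
  surjective := hφ
  exact_zero := by
    have : LinearMap.range ((LinearMap.ker φ).subtype ∘ₗ ε) = LinearMap.ker φ := by
      rw [LinearMap.range_comp, LinearMap.range_eq_top.mpr h.surjective, Submodule.map_top,
        Submodule.range_subtype]
    exact LinearMap.exact_iff.mpr this.symm
  exact_succ
    | 0 => by
      have : LinearMap.ker ((LinearMap.ker φ).subtype ∘ₗ ε) = LinearMap.range (d 0) := by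
        rw [LinearMap.ker_comp_of_ker_eq_bot _ (Submodule.ker_subtype _)]
        exact LinearMap.exact_iff.mp h.exact_zero
      exact LinearMap.exact_iff.mpr this
    | i + 1 => h.exact_succ i

/-- Dropping the first step of a minimal free resolution. -/
theorem IsMinimalFreeResolution.tail [IsLocalRing R] {b : ℕ → ℕ}
    {d : ∀ i, (Fin (b (i + 1)) → R) →ₗ[R] (Fin (b i) → R)} {ε : (Fin (b 0) → R) →ₗ[R] M}
    (h : IsMinimalFreeResolution R M b d ε) :
    IsMinimalFreeResolution R (LinearMap.ker ε) (fun i => b (i + 1)) (fun i => d (i + 1))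
      ((d 0).codRestrict (LinearMap.ker ε) fun v => h.exact_zero.apply_apply_eq_zero v) where
  surjective := by
    rintro ⟨y, hy⟩
    obtain ⟨v, hv⟩ := (h.exact_zero y).mp hy
    exact ⟨v, Subtype.ext hv⟩
  exact_zero := by
    refine LinearMap.exact_iff.mpr ((LinearMap.ker_codRestrict _ _ _).trans ?_)
    exact LinearMap.exact_iff.mp (h.exact_succ 0)
  exact_succ i := h.exact_succ (i + 1)
  minimal i := h.minimal (i + 1)

/-- A section `s` of `φ` gives the projector `π = 1 - s φ` onto `ker φ`. Applying `π` to `ker φ ≤ 𝔪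
F` yields `ker φ ≤ 𝔪 ker φ`, and Nakayama concludes. -/
theorem ker_eq_bot_of_minimal_of_projective [IsLocalRing R] [Module.Projective R M] {n : ℕ}
    {φ : (Fin n → R) →ₗ[R] M} (hφ : Function.Surjective φ)
    (hk : LinearMap.ker φ ≤ maximalIdeal R • ⊤) : LinearMap.ker φ = ⊥ := by
  obtain ⟨s, hs⟩ := Module.projective_lifting_property φ LinearMap.id hφ
  let π : (Fin n → R) →ₗ[R] (Fin n → R) := LinearMap.id - s ∘ₗ φ
  have hπk : ∀ v ∈ LinearMap.ker φ, π v = v := fun v hv => by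
    simp [π, LinearMap.mem_ker.mp hv]
  have hπ : Submodule.map π ⊤ = LinearMap.ker φ := by
    apply le_antisymm
    · rintro _ ⟨v, -, rfl⟩
      have : φ (s (φ v)) = φ v := LinearMap.congr_fun hs (φ v)
      simp [π, this]
    · exact fun v hv => ⟨v, trivial, hπk v hv⟩
  refine Submodule.eq_bot_of_le_smul_of_le_jacobson_bot (maximalIdeal R) _
    (hπ ▸ Module.Finite.fg_top.map π) (fun v hv => ?_)
    (by rw [jacobson_eq_maximalIdeal]; exact bot_ne_top)
  have := Submodule.mem_map_of_mem (f := π) (hk hv)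
  rwa [Submodule.map_smul'', hπ, hπk v hv] at this

/-- A minimal free resolution of a module of projective dimension less than `n` stops before
the step `n`. -/
theorem IsMinimalFreeResolution.rank_eq_zero [IsLocalRing R] (n : ℕ) {M : Type u}
    [AddCommGroup M] [Module R M] {b : ℕ → ℕ}
    {d : ∀ i, (Fin (b (i + 1)) → R) →ₗ[R] (Fin (b i) → R)} {ε : (Fin (b 0) → R) →ₗ[R] M}
    (h : IsMinimalFreeResolution R M b d ε)
    (hM : HasProjectiveDimensionLT (ModuleCat.of R M) n) (i : ℕ) (hi : n ≤ i) : b i = 0 := by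
  have hker : LinearMap.ker ε ≤ IsLocalRing.maximalIdeal R • ⊤ := by
    rw [LinearMap.exact_iff.mp h.exact_zero]
    exact h.minimal 0
  induction i generalizing n M b with
  | zero =>
    obtain rfl : n = 0 := by omega
    have hM0 := ModuleCat.isZero_iff_subsingleton.mp
      (isZero_of_hasProjectiveDimensionLT_zero (ModuleCat.of R M))
    by_contra hb
    have h1 : (Pi.single (⟨0, Nat.pos_of_ne_zero hb⟩ : Fin (b 0)) (1 : R)) ∈
        LinearMap.ker ε := @Subsingleton.elim M hM0 _ _
    have h2 := (mem_ideal_smul_top_pi_iff _ _).mp (hker h1) ⟨0, Nat.pos_of_ne_zero hb⟩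
    rw [Pi.single_eq_same] at h2
    exact (Ideal.ne_top_iff_one _).mp Ideal.IsPrime.ne_top' h2
  | succ i ih =>
    have hS := LinearMap.shortExact_shortComplexKer h.surjective
    have hker' : LinearMap.ker ((d 0).codRestrict (LinearMap.ker ε)
        fun v => h.exact_zero.apply_apply_eq_zero v) ≤ IsLocalRing.maximalIdeal R • ⊤ := by
      rw [LinearMap.exact_iff.mp h.tail.exact_zero]
      exact h.tail.minimal 0
    have key : ∀ m, m ≤ i → HasProjectiveDimensionLT (ModuleCat.of R (LinearMap.ker ε)) m →
        b (i + 1) = 0 := fun m hm hk => ih m h.tail hk hm hker'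
    -- For `n ≤ 1` the module is projective and its first syzygy vanishes. Otherwise the bound drops
    -- by one on passing to the syzygy.
    rcases Nat.lt_or_ge n 2 with hn | hn
    · have : HasProjectiveDimensionLT (ModuleCat.of R M) 1 :=
        hasProjectiveDimensionLT_of_ge _ n 1 (by omega)
      have : Module.Projective R M := (IsProjective.iff_projective M).mpr inferInstance
      have hb := ker_eq_bot_of_minimal_of_projective h.surjective hker
      refine key 0 (Nat.zero_le _) (Limits.IsZero.hasProjectiveDimensionLT_zero ?_)
      rw [hb]
      exact ModuleCat.isZero_of_subsingleton _
    · obtain ⟨n, rfl⟩ := Nat.exists_eq_add_of_le' hn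
      exact key (n + 1) (by omega) ((hS.hasProjectiveDimensionLT_X₃_iff n
        (ModuleCat.projective_of_free (Pi.basisFun R (Fin (b 0))))).mp hM)

end Splice

end FreeResolutions

/-! ### Depth through `Ext(k, -)`: the inequality `pd ≤ depth` and the acyclicity lemma. -/

section Depth

open IsLocalRing Abelian

variable {R : Type u} [CommRing R] {A B C : Type u} [AddCommGroup A] [Module R A]
  [AddCommGroup B] [Module R B] [AddCommGroup C] [Module R C] {f : A →ₗ[R] B} {g : B →ₗ[R] C}

/-- The short complex attached to an exact pair of linear maps. -/
abbrev exactShortComplex (h : Function.Exact f g) : ShortComplex (ModuleCat.{u} R) :=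
  ModuleCat.shortComplexOfCompEqZero f g h.linearMap_comp_eq_zero

theorem shortExact_exactShortComplex (h : Function.Exact f g) (hf : Function.Injective f)
    (hg : Function.Surjective g) : (exactShortComplex h).ShortExact :=
  ModuleCat.shortComplex_shortExact _ h hf hg

/-- A matrix is the sum of its entries times the matrix units. -/
theorem linearMap_eq_sum_single {m n : ℕ} (φ : (Fin m → R) →ₗ[R] (Fin n → R)) :
    φ = ∑ i, ∑ j, φ (Pi.single i 1) j •
      (LinearMap.single R (fun _ => R) j ∘ₗ LinearMap.proj i) := by
  refine LinearMap.pi_ext' fun i => LinearMap.ext_ring ?_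
  ext j
  simp [Pi.single_apply, Finset.sum_apply]

/-- The exact pair `im d_{i+1} → F_{i+1} → im d_i` of an exact complex. -/
theorem exact_range_subtype_rangeRestrict {b : ℕ → ℕ}
    {d : ∀ i, (Fin (b (i + 1)) → R) →ₗ[R] (Fin (b i) → R)} (i : ℕ)
    (h : Function.Exact (d (i + 1)) (d i)) :
    Function.Exact (LinearMap.range (d (i + 1))).subtype (d i).rangeRestrict := by
  rw [LinearMap.exact_iff, LinearMap.ker_rangeRestrict, Submodule.range_subtype]
  exact LinearMap.exact_iff.mp h

variable (R) [IsLocalRing R]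

/-- The vanishing of `Ext^i(k, N)` for the residue field `k`. -/
def ExtVanishes (i : ℕ) (N : Type u) [AddCommGroup N] [Module R N] : Prop :=
  Subsingleton (Ext (ModuleCat.of R (R ⧸ maximalIdeal R)) (ModuleCat.of R N) i)

variable {R}

theorem ExtVanishes.left {i : ℕ} (h : Function.Exact f g) (hf : Function.Injective f)
    (hg : Function.Surjective g) (hC : ExtVanishes R i C) (hB : ExtVanishes R (i + 1) B) :
    ExtVanishes R (i + 1) A := by
  refine ⟨fun a b => ?_⟩
  have key : ∀ x : Ext (ModuleCat.of R (R ⧸ maximalIdeal R)) (ModuleCat.of R A) (i + 1), x = 0 := by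
    intro x
    obtain ⟨y, rfl⟩ := Ext.covariant_sequence_exact₁ _ (shortExact_exactShortComplex h hf hg) x
      (hB.elim _ _) rfl
    rw [hC.elim y 0, Ext.zero_comp]
  rw [key a, key b]

theorem ExtVanishes.right {i : ℕ} (h : Function.Exact f g) (hf : Function.Injective f)
    (hg : Function.Surjective g) (hB : ExtVanishes R i B) (hA : ExtVanishes R (i + 1) A) :
    ExtVanishes R i C := by
  refine ⟨fun a b => ?_⟩
  have key : ∀ x : Ext (ModuleCat.of R (R ⧸ maximalIdeal R)) (ModuleCat.of R C) i, x = 0 := by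
    intro x
    obtain ⟨y, rfl⟩ := Ext.covariant_sequence_exact₃ _ (shortExact_exactShortComplex h hf hg) x rfl
      (hA.elim _ _)
    rw [hB.elim y 0, Ext.zero_comp]
  rw [key a, key b]

theorem ExtVanishes.of_injective (hf : Function.Injective f) (hB : ExtVanishes R 0 B) :
    ExtVanishes R 0 A := by
  have : Mono (ModuleCat.ofHom f) := (ModuleCat.mono_iff_injective _).mpr hf
  exact ⟨fun a b => Ext.postcomp_mk₀_injective_of_mono _ (ModuleCat.ofHom f) (hB.elim _ _)⟩

theorem ExtVanishes.of_retract {i : ℕ} (hB : ExtVanishes R i B)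
    {g : B →ₗ[R] A} (hgf : g ∘ₗ f = LinearMap.id) : ExtVanishes R i A := by
  refine ⟨fun a b => ?_⟩
  have key : ∀ x : Ext (ModuleCat.of R (R ⧸ maximalIdeal R)) (ModuleCat.of R A) i,
      x = (x.comp (Ext.mk₀ (ModuleCat.ofHom f)) (add_zero i)).comp
        (Ext.mk₀ (ModuleCat.ofHom g)) (add_zero i) := by
    intro x
    rw [Ext.comp_assoc_of_third_deg_zero, Ext.mk₀_comp_mk₀, ← ModuleCat.ofHom_comp, hgf,
      ModuleCat.ofHom_id, Ext.comp_mk₀_id]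
  rw [key a, key b, hB.elim (a.comp _ _) (b.comp _ _)]

theorem ExtVanishes.of_subsingleton [Subsingleton A] (i : ℕ) : ExtVanishes R i A := by
  refine ⟨fun a b => ?_⟩
  have h0 : 𝟙 (ModuleCat.of R A) = 0 := (ModuleCat.isZero_of_subsingleton _).eq_of_src _ _
  rw [← Ext.comp_mk₀_id a, ← Ext.comp_mk₀_id b, h0, Ext.mk₀_zero, Ext.comp_zero, Ext.comp_zero]

/-- An element killed by the maximal ideal is the value at `1` of a map from the residue field,
which is a class in `Ext^0`. -/
theorem ExtVanishes.eq_zero (h : ExtVanishes R 0 A) {z : A}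
    (hz : ∀ y ∈ maximalIdeal R, y • z = 0) : z = 0 := by
  let φ : (R ⧸ maximalIdeal R) →ₗ[R] A :=
    (maximalIdeal R).liftQ (LinearMap.toSpanSingleton R A z) fun y hy => by simpa using hz y hy
  have h0 : ModuleCat.ofHom φ = 0 := (Ext.mk₀_eq_zero_iff _).mp (h.elim _ _)
  have h1 : φ (Submodule.Quotient.mk 1) = 0 :=
    LinearMap.congr_fun (congrArg ModuleCat.Hom.hom h0) (Submodule.Quotient.mk 1)
  have h2 : φ (Submodule.Quotient.mk 1) = (1 : R) • z := Submodule.liftQ_apply _ _ _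
  rwa [h1, one_smul, eq_comm] at h2

theorem smul_ext_residueField {y : R} (hy : y ∈ maximalIdeal R) {X : ModuleCat.{u} R} {i : ℕ}
    (x : Ext (ModuleCat.of R (R ⧸ maximalIdeal R)) X i) : y • x = 0 := by
  have h0 : y • 𝟙 (ModuleCat.of R (R ⧸ maximalIdeal R)) = 0 := by
    refine ModuleCat.hom_ext (LinearMap.ext fun z => ?_)
    obtain ⟨z, rfl⟩ := Submodule.Quotient.mk_surjective _ z
    exact (Submodule.Quotient.mk_eq_zero (maximalIdeal R)).mpr
      (Ideal.mul_mem_right z _ hy)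
  have : y • x = (Ext.mk₀ (y • 𝟙 (ModuleCat.of R (R ⧸ maximalIdeal R)))).comp x (zero_add i) := by
    simp [Ext.mk₀_smul]
  rw [this, h0, Ext.mk₀_zero, Ext.zero_comp]

/-- `Ext` out of the residue field is killed by the maximal ideal, and `φ` is a combination of
matrix units with coefficients there. -/
theorem ext_comp_eq_zero_of_minimal {m n i : ℕ} {φ : (Fin m → R) →ₗ[R] (Fin n → R)}
    (hφ : LinearMap.range φ ≤ maximalIdeal R • ⊤)
    (x : Ext (ModuleCat.of R (R ⧸ maximalIdeal R)) (ModuleCat.of R (Fin m → R)) i) :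
    x.comp (Ext.mk₀ (ModuleCat.ofHom φ)) (add_zero i) = 0 := by
  have h : ModuleCat.ofHom φ = ∑ i, ∑ j, φ (Pi.single i 1) j •
      ModuleCat.ofHom (LinearMap.single R (fun _ => R) j ∘ₗ LinearMap.proj i) := by
    ext1
    simp only [ModuleCat.hom_sum, ModuleCat.hom_smul, ModuleCat.hom_ofHom]
    exact linearMap_eq_sum_single φ
  rw [h]
  simp only [Ext.mk₀_sum, Ext.comp_sum, Ext.mk₀_smul, Ext.comp_smul]
  refine Finset.sum_eq_zero fun i _ => Finset.sum_eq_zero fun j _ => ?_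
  exact smul_ext_residueField
    ((mem_ideal_smul_top_pi_iff _ _).mp (hφ ⟨Pi.single i 1, rfl⟩) j) _

theorem ExtVanishes.pi {i : ℕ} (h : ExtVanishes R i R) (n : ℕ) : ExtVanishes R i (Fin n → R) := by
  have key : ∀ x : Ext (ModuleCat.of R (R ⧸ maximalIdeal R)) (ModuleCat.of R (Fin n → R)) i,
      x = 0 := by
    intro x
    have h1 : 𝟙 (ModuleCat.of R (Fin n → R)) = ∑ j : Fin n,
        ModuleCat.ofHom (LinearMap.proj j) ≫
          ModuleCat.ofHom (LinearMap.single R (fun _ => R) j) := by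
      ext1
      refine LinearMap.ext fun v => ?_
      simp only [ModuleCat.hom_id, ModuleCat.hom_sum, ModuleCat.hom_comp, LinearMap.sum_apply]
      exact (Finset.univ_sum_single v).symm
    rw [← Ext.comp_mk₀_id x, h1, Ext.mk₀_sum, Ext.comp_sum]
    refine Finset.sum_eq_zero fun j _ => ?_
    rw [← Ext.mk₀_comp_mk₀, ← Ext.comp_assoc_of_third_deg_zero]
    have : x.comp (Ext.mk₀ (ModuleCat.ofHom (LinearMap.proj j))) (add_zero i) =
      (0 : Ext _ (ModuleCat.of R R) i) := h.elim _ _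
    rw [this, Ext.zero_comp]
  exact ⟨fun a b => by rw [key a, key b]⟩

variable {b : ℕ → ℕ} {d : ∀ i, (Fin (b (i + 1)) → R) →ₗ[R] (Fin (b i) → R)}

/-- The inequality `pd ≤ depth` of Auslander and Buchsbaum. -/
theorem extVanishes_of_minimal_exact (hex : ∀ i, Function.Exact (d (i + 1)) (d i))
    (hmin : ∀ i, LinearMap.range (d i) ≤ maximalIdeal R • ⊤) {s : ℕ} (hs : b s ≠ 0)
    (hb : ∀ i, s < i → b i = 0) (i : ℕ) (hi : i < s) : ExtVanishes R i R := by
  induction i using Nat.strong_induction_on with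
  | _ j ih =>
  obtain ⟨t, rfl⟩ : ∃ t, s = t + j + 1 := ⟨s - j - 1, by omega⟩
  have hF : ∀ i < j, ∀ n, ExtVanishes R i (Fin n → R) := fun i hi n =>
    (ih i hi (by omega)).pi n
  -- The image of `d t` embeds in a free module. The sequences `0 → im d_{t+i+1} → F_{t+i+1} → im
  -- d_{t+i} → 0` then raise the degree of vanishing one step at a time.
  have him : ∀ i < j, ExtVanishes R i (LinearMap.range (d (t + i))) := by
    intro i
    induction i with
    | zero => exact fun hj => (hF 0 hj (b t)).of_injective (Submodule.subtype_injective _)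
    | succ i hi =>
      intro hj
      exact ExtVanishes.left (exact_range_subtype_rangeRestrict (t + i) (hex _))
        (Submodule.subtype_injective _) (d (t + i)).surjective_rangeRestrict
        (hi (by omega)) (hF _ hj _)
  have hinj : Function.Injective (d (t + j)) := by
    rw [← LinearMap.ker_eq_bot, LinearMap.exact_iff.mp (hex (t + j)), LinearMap.range_eq_bot]
    have : IsEmpty (Fin (b (t + j + 1 + 1))) := by
      rw [hb _ (by omega)]; infer_instance
    exact LinearMap.ext fun v => by rw [Subsingleton.elim v 0, map_zero, map_zero]
  -- The last differential `F_s → F_{s-1}` acts by zero on `Ext^j` by minimality. It also acts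
  -- injectively, being a monomorphism if `j = 0` and because `Ext^{j-1}(k, im d_{t+j-1}) = 0`
  -- otherwise. So `Ext^j(k, F_s) = 0`, and `R` is a retract of `F_s ≠ 0`.
  have hFs : ExtVanishes R j (Fin (b (t + j + 1)) → R) := by
    have key : ∀ x : Ext (ModuleCat.of R (R ⧸ maximalIdeal R))
        (ModuleCat.of R (Fin (b (t + j + 1)) → R)) j, x = 0 := by
      intro x
      have hx := ext_comp_eq_zero_of_minimal (hmin (t + j)) x
      rcases j with _ | j
      · have : Mono (ModuleCat.ofHom (d (t + 0))) := (ModuleCat.mono_iff_injective _).mpr hinj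
        refine Ext.postcomp_mk₀_injective_of_mono _ (ModuleCat.ofHom (d (t + 0))) ?_
        rw [map_zero]
        exact hx
      · have hexact : Function.Exact (d (t + j + 1)) (d (t + j)).rangeRestrict := by
          rw [LinearMap.exact_iff, LinearMap.ker_rangeRestrict]
          exact LinearMap.exact_iff.mp (hex _)
        obtain ⟨y, rfl⟩ := Ext.covariant_sequence_exact₁ _ (shortExact_exactShortComplex hexact
          hinj (d (t + j)).surjective_rangeRestrict) x hx rfl
        have hy : y = 0 := (him j (by omega)).elim y 0
        rw [hy, Ext.zero_comp]
    exact ⟨fun a b => by rw [key a, key b]⟩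
  let e : Fin (b (t + j + 1)) := ⟨0, Nat.pos_of_ne_zero hs⟩
  refine ExtVanishes.of_retract (f := LinearMap.single R (fun _ => R) e) hFs
    (g := LinearMap.proj e) ?_
  ext; simp

theorem ExtVanishes.eq_zero_of_pow (h : ExtVanishes R 0 A) {z : A} (N : ℕ)
    (hz : ∀ y ∈ maximalIdeal R ^ N, y • z = 0) : z = 0 := by
  induction N with
  | zero => simpa using hz 1 (by simp)
  | succ N ih =>
    refine ih fun y hy => h.eq_zero fun y' hy' => ?_
    rw [smul_smul]
    exact hz _ (by rw [pow_succ']; exact Ideal.mul_mem_mul hy' hy)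

/-- The acyclicity lemma of Peskine and Szpiro for a complex of finite free modules whose homology
is annihilated by a power of the maximal ideal. -/
theorem exact_of_extVanishes {s : ℕ} (hd : ∀ i, d i ∘ₗ d (i + 1) = 0) (hb : ∀ i, s < i → b i = 0)
    (hR : ∀ i < s, ExtVanishes R i R) (N : ℕ)
    (hH : ∀ i, ∀ v ∈ LinearMap.ker (d i), ∀ y ∈ maximalIdeal R ^ N,
      y • v ∈ LinearMap.range (d (i + 1))) (i : ℕ) : Function.Exact (d (i + 1)) (d i) := by
  have hle : ∀ i, LinearMap.range (d (i + 1)) ≤ LinearMap.ker (d i) := fun i =>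
    LinearMap.range_le_ker_iff.mpr (hd i)
  have hsub : ∀ i, s < i → Subsingleton (Fin (b i) → R) := fun i hi => by
    rw [hb i hi]; infer_instance
  -- Descending induction on `i`: exactness at `F_{i+1}` is carried along with the vanishing of
  -- `Ext^e(k, im d_i)` for `e ≤ i`.
  suffices H : ∀ j i, s ≤ i + j → Function.Exact (d (i + 1)) (d i) ∧
      ∀ e ≤ i, ExtVanishes R e (LinearMap.range (d i)) from (H s i (by omega)).1
  intro j
  induction j with
  | zero =>
    intro i hi
    have := hsub (i + 1) (by omega)
    refine ⟨fun v => ⟨fun _ => ⟨0, Subsingleton.elim _ _⟩, ?_⟩, fun e _ => ?_⟩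
    · intro _
      rw [Subsingleton.elim v 0, map_zero]
    · have : Subsingleton (LinearMap.range (d i)) := (d i).surjective_rangeRestrict.subsingleton
      exact ExtVanishes.of_subsingleton e
  | succ j ih =>
    intro i hi
    rcases Nat.lt_or_ge i s with his | his
    swap
    · exact ih i (by omega)
    obtain ⟨-, hE⟩ := ih (i + 1) (by omega)
    have hZ : ExtVanishes R 0 (LinearMap.ker (d i)) :=
      ((hR 0 (by omega)).pi _).of_injective (Submodule.subtype_injective _)
    let ι := Submodule.inclusion (hle i)
    -- The homology has no socle, since `Ext^0(k, ker d_i)` and `Ext^1(k, im d_{i+1})` vanish. As it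
    -- is killed by a power of the maximal ideal, it is zero.
    have hHom : ExtVanishes R 0 (LinearMap.ker (d i) ⧸ LinearMap.range ι) :=
      ExtVanishes.right (LinearMap.exact_map_mkQ_range ι) (Submodule.inclusion_injective _)
        (Submodule.mkQ_surjective _) hZ (hE 1 (by omega))
    have hex : Function.Exact (d (i + 1)) (d i) := by
      rw [LinearMap.exact_iff]
      refine le_antisymm (fun v hv => ?_) (hle i)
      have h0 : (LinearMap.range ι).mkQ ⟨v, hv⟩ = 0 := by
        refine hHom.eq_zero_of_pow N fun y hy => ?_
        rw [← map_smul]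
        refine (Submodule.Quotient.mk_eq_zero _).mpr ⟨⟨y • v, hH i v hv y hy⟩, rfl⟩
      obtain ⟨⟨w, hw⟩, hwv⟩ := (Submodule.Quotient.mk_eq_zero _).mp h0
      have : w = v := congrArg Subtype.val hwv
      exact this ▸ hw
    refine ⟨hex, fun e he => ?_⟩
    exact ExtVanishes.right (exact_range_subtype_rangeRestrict i hex)
      (Submodule.subtype_injective _) (d i).surjective_rangeRestrict
      ((hR e (by omega)).pi _) (hE (e + 1) (by omega))

end Depth

/-! ### Applying a ring endomorphism to the entries of matrices. -/

section Twist

variable {R : Type u} [CommRing R] (f : R →+* R)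

/-- The linear map whose matrix is obtained by applying a ring endomorphism to the entries. -/
def twistMap {m n : ℕ} (φ : (Fin m → R) →ₗ[R] (Fin n → R)) : (Fin m → R) →ₗ[R] (Fin n → R) :=
  Matrix.toLin' ((LinearMap.toMatrix' φ).map f)

theorem twistMap_comp {l m n : ℕ} (φ : (Fin m → R) →ₗ[R] (Fin n → R))
    (ψ : (Fin l → R) →ₗ[R] (Fin m → R)) :
    twistMap f (φ ∘ₗ ψ) = twistMap f φ ∘ₗ twistMap f ψ := by
  simp only [twistMap, LinearMap.toMatrix'_comp, Matrix.map_mul, Matrix.toLin'_mul]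

theorem twistMap_add {m n : ℕ} (φ ψ : (Fin m → R) →ₗ[R] (Fin n → R)) :
    twistMap f (φ + ψ) = twistMap f φ + twistMap f ψ := by
  simp only [twistMap, map_add, Matrix.map_add f (map_add f)]

theorem twistMap_zero {m n : ℕ} : twistMap f (0 : (Fin m → R) →ₗ[R] (Fin n → R)) = 0 := by
  simp only [twistMap, map_zero, Matrix.map_zero f (map_zero f)]

theorem twistMap_smul_id {m : ℕ} (y : R) :
    twistMap f (y • LinearMap.id : (Fin m → R) →ₗ[R] (Fin m → R)) = f y • LinearMap.id := by
  have : (LinearMap.toMatrix' (y • LinearMap.id : (Fin m → R) →ₗ[R] (Fin m → R))).map f =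
      f y • (1 : Matrix (Fin m) (Fin m) R) := by
    rw [map_smul, LinearMap.toMatrix'_id]
    ext i j
    by_cases h : i = j <;> simp [h]
  rw [twistMap, this, map_smul, Matrix.toLin'_one]

theorem twistMap_apply {m n : ℕ} (φ : (Fin m → R) →ₗ[R] (Fin n → R)) (v : Fin m → R) (i : Fin n) :
    twistMap f φ v i = ∑ j, f (φ (Pi.single j 1) i) * v j := by
  simp [twistMap, Matrix.toLin'_apply, Matrix.mulVec, dotProduct, LinearMap.toMatrix'_apply,
    Pi.single]

theorem twistMap_comp_apply {m n : ℕ} (φ : (Fin m → R) →ₗ[R] (Fin n → R)) (v : Fin m → R) :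
    twistMap f φ (fun j => f (v j)) = fun i => f (φ v i) := by
  funext i
  have h : φ v = ∑ j, v j • φ (Pi.single j 1) := by
    conv_lhs => rw [← (Pi.basisFun R (Fin m)).sum_repr v]
    simp
  rw [twistMap_apply, h]
  simp [map_sum, mul_comm]

theorem exists_comp_eq_of_range_le {l m n : ℕ} (φ : (Fin m → R) →ₗ[R] (Fin n → R))
    (ψ : (Fin l → R) →ₗ[R] (Fin n → R)) (h : LinearMap.range ψ ≤ LinearMap.range φ) :
    ∃ χ, φ ∘ₗ χ = ψ := by
  obtain ⟨χ, hχ⟩ := Module.projective_lifting_property φ.rangeRestrict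
    (ψ.codRestrict (LinearMap.range φ) fun v => h ⟨v, rfl⟩) φ.surjective_rangeRestrict
  exact ⟨χ, LinearMap.ext fun v => congrArg Subtype.val (LinearMap.congr_fun hχ v)⟩

/-- Multiplication by an element annihilating the cokernel is null-homotopic on an exact complex of
free modules. -/
theorem exists_homotopy_smul {b : ℕ → ℕ} {d : ∀ i, (Fin (b (i + 1)) → R) →ₗ[R] (Fin (b i) → R)}
    (hex : ∀ i, Function.Exact (d (i + 1)) (d i)) {y : R}
    (hy : ∀ v, y • v ∈ LinearMap.range (d 0)) (i : ℕ) :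
    ∃ (h' : (Fin (b (i + 1)) → R) →ₗ[R] (Fin (b (i + 1 + 1)) → R))
      (h : (Fin (b i) → R) →ₗ[R] (Fin (b (i + 1)) → R)),
      d (i + 1) ∘ₗ h' + h ∘ₗ d i = y • LinearMap.id := by
  -- The hypothesis on `h` says that `y - h d_i` maps into `ker d_i = im d_{i+1}`, so it lifts
  -- through `d_{i+1}`.
  have step : ∀ i (h : (Fin (b i) → R) →ₗ[R] (Fin (b (i + 1)) → R)),
      d i ∘ₗ h ∘ₗ d i = y • d i → ∃ h', d (i + 1) ∘ₗ h' + h ∘ₗ d i = y • LinearMap.id := by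
    intro i h hh
    obtain ⟨h', hh'⟩ := exists_comp_eq_of_range_le (d (i + 1)) (y • LinearMap.id - h ∘ₗ d i) (by
      rw [← LinearMap.exact_iff.mp (hex i)]
      rintro _ ⟨v, rfl⟩
      have := LinearMap.congr_fun hh v
      simp only [LinearMap.comp_apply, LinearMap.smul_apply] at this
      simp [this])
    exact ⟨h', by rw [hh', sub_add_cancel]⟩
  induction i with
  | zero =>
    obtain ⟨h, hh⟩ := exists_comp_eq_of_range_le (d 0) (y • LinearMap.id) (by
      rintro _ ⟨v, rfl⟩
      exact hy v)
    obtain ⟨h', hh'⟩ := step 0 h (by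
      rw [← LinearMap.comp_assoc, hh]; rfl)
    exact ⟨h', h, hh'⟩
  | succ i ih =>
    obtain ⟨h', h, hh⟩ := ih
    obtain ⟨h'', hh''⟩ := step (i + 1) h' (by
      rw [← LinearMap.comp_assoc, ← sub_eq_iff_eq_add.mpr hh.symm, LinearMap.sub_comp,
        LinearMap.comp_assoc, (hex i).linearMap_comp_eq_zero, LinearMap.comp_zero, sub_zero]
      rfl)
    exact ⟨h'', h', hh''⟩

/-- Twisting respects sums and composites, so a null-homotopy of multiplication by `z ∈ J` becomes
one of multiplication by `f z`. Exactness of the twisted complex is not needed. -/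
theorem smul_mem_range_twistMap {b : ℕ → ℕ}
    {d : ∀ i, (Fin (b (i + 1)) → R) →ₗ[R] (Fin (b i) → R)}
    (hex : ∀ i, Function.Exact (d (i + 1)) (d i)) {J : Ideal R}
    (hJ : ∀ y ∈ J, ∀ v, y • v ∈ LinearMap.range (d 0)) (i : ℕ)
    {v : Fin (b (i + 1)) → R} (hv : v ∈ LinearMap.ker (twistMap f (d i))) {y : R}
    (hy : y ∈ J.map f) : y • v ∈ LinearMap.range (twistMap f (d (i + 1))) := by
  suffices J.map f ≤ (LinearMap.range (twistMap f (d (i + 1)))).comap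
    (LinearMap.toSpanSingleton R _ v) from this hy
  refine Ideal.span_le.mpr ?_
  rintro _ ⟨z, hz, rfl⟩
  obtain ⟨h', h, hh⟩ := exists_homotopy_smul hex (hJ z hz) i
  have := congrArg (twistMap f) hh
  rw [twistMap_add, twistMap_comp, twistMap_comp, twistMap_smul_id] at this
  have hv' := LinearMap.congr_fun this v
  simp only [LinearMap.add_apply, LinearMap.comp_apply, LinearMap.mem_ker.mp hv, map_zero,
    add_zero, LinearMap.smul_apply, LinearMap.id_apply] at hv'
  exact ⟨_, hv'⟩

end Twist

/-! ### Frobenius preserves exactness of finite free resolutions. -/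

section FrobeniusExactness

open IsLocalRing

variable {R : Type u} [CommRing R]

theorem pow_mem_frobPower (p : ℕ) [ExpChar R p] {K : Ideal R} {y : R} (hy : y ∈ K) (n : ℕ) :
    y ^ p ^ n ∈ frobPower p K n :=
  Ideal.subset_span ⟨y, hy, rfl⟩

theorem frobPower_le (p : ℕ) [Fact p.Prime] [ExpChar R p] (K : Ideal R) (n : ℕ) :
    frobPower p K n ≤ K := by
  refine Ideal.span_le.mpr ?_
  rintro _ ⟨y, hy, rfl⟩
  exact Ideal.pow_mem_of_mem K hy _ (pow_pos (Fact.out : p.Prime).pos n)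

theorem radical_frobPower (p : ℕ) [Fact p.Prime] [ExpChar R p] (K : Ideal R) (n : ℕ) :
    (frobPower p K n).radical = K.radical := by
  refine le_antisymm (Ideal.radical_mono (frobPower_le p K n)) fun y hy => ?_
  obtain ⟨N, hN⟩ := hy
  exact ⟨N * p ^ n, by rw [pow_mul]; exact pow_mem_frobPower p hN n⟩

/-- Vanishing of `Tor_1(R/J, ^{f^n}R)` for an `𝔪`-primary ideal `J` of finite projective dimension,
in terms of a presentation of `J`: the relations of the `q`-th powers of suitable generators are
generated by the `q`-th powers of their relations. -/
theorem exists_presentation_of_projectiveDimension_ne_top [IsLocalRing R] [IsNoetherianRing R]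
    (p : ℕ) [Fact p.Prime] [CharP R p] (J : Ideal R) (hJ : J.radical = maximalIdeal R)
    (hpd : projectiveDimension (ModuleCat.of R J) ≠ ⊤) :
    ∃ (m l : ℕ) (g : Fin m → R) (A : (Fin l → R) →ₗ[R] (Fin m → R)),
      Ideal.span (Set.range g) = J ∧ ∀ n (v : Fin m → R),
        ∑ j, g j ^ p ^ n * v j = 0 ↔ v ∈ LinearMap.range (twistMap (iterateFrobenius R p n) A) := by
  obtain ⟨c, δ, ε, h⟩ := exists_isMinimalFreeResolution (R := R) J
  obtain ⟨s, hs⟩ : ∃ s, ∀ i, s ≤ i → c i = 0 := by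
    obtain ⟨s, hs⟩ := (projectiveDimension_ne_top_iff _).mp hpd
    exact ⟨s + 1, fun i hi => h.rank_eq_zero (s + 1) hs i hi⟩
  let g : Fin (c 0) → R := fun j => ε (Pi.single j 1)
  -- The resolution of `J` is prolonged by `J ⊆ R` to one of `R/J`, which is minimal because `J`
  -- lies in the maximal ideal.
  let d₀ : (Fin (c 0) → R) →ₗ[R] (Fin 1 → R) := LinearMap.pi fun _ => J.subtype ∘ₗ ε
  have hd₀ : LinearMap.ker d₀ = LinearMap.ker ε := by
    ext v
    simp [d₀, LinearMap.mem_ker, funext_iff]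
  let b := consRank 1 c
  let d : ∀ i, (Fin (b (i + 1)) → R) →ₗ[R] (Fin (b i) → R) := consDiff d₀ δ
  have hex : ∀ i, Function.Exact (d (i + 1)) (d i)
    | 0 => LinearMap.exact_iff.mpr (hd₀.trans (LinearMap.exact_iff.mp h.exact_zero))
    | i + 1 => h.exact_succ i
  have hJm : J ≤ maximalIdeal R := hJ ▸ Ideal.le_radical
  have hmin : ∀ i, LinearMap.range (d i) ≤ maximalIdeal R • ⊤
    | 0 => by
      rintro _ ⟨v, rfl⟩
      exact (mem_ideal_smul_top_pi_iff _ _).mpr fun _ => hJm (ε v).2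
    | i + 1 => h.minimal i
  have hb : ∀ i, s + 1 ≤ i → b i = 0
    | 0, hi => absurd hi (by omega)
    | i + 1, hi => hs i (by omega)
  have hb0 : b 0 ≠ 0 := one_ne_zero
  -- The last nonzero degree is needed exactly: the depth bound uses a nonzero top term, the
  -- acyclicity lemma zeros beyond it.
  let s₀ := Nat.findGreatest (fun i => b i ≠ 0) (s + 1)
  have hs₀ : b s₀ ≠ 0 := Nat.findGreatest_spec (P := fun i => b i ≠ 0) (Nat.zero_le _) hb0
  have hb₀ : ∀ i, s₀ < i → b i = 0 := fun i hi => by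
    rcases Nat.lt_or_ge (s + 1) i with h1 | h1
    · exact hb i h1.le
    · exact not_not.mp (Nat.findGreatest_is_greatest hi h1)
  have hdepth := extVanishes_of_minimal_exact hex hmin hs₀ hb₀
  have hJd : ∀ y ∈ J, ∀ v : Fin 1 → R, y • v ∈ LinearMap.range d₀ := by
    intro y hy v
    obtain ⟨w, hw⟩ := h.surjective (v 0 • ⟨y, hy⟩)
    refine ⟨w, ?_⟩
    funext i
    obtain rfl := Subsingleton.elim i 0
    simp [d₀, hw, mul_comm]
  refine ⟨c 0, c 1, g, δ 0, ?_, fun n v => ?_⟩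
  · have : Ideal.span (Set.range g) = LinearMap.range (J.subtype ∘ₗ ε) := by
      rw [← Set.image_univ, LinearMap.range_eq_map, ← (Pi.basisFun R (Fin (c 0))).span_eq,
        Submodule.map_span, ← Set.range_comp, Set.image_univ]
      congr 2
      funext j
      simp [g]
    rw [this, LinearMap.range_comp, LinearMap.range_eq_top.mpr h.surjective, Submodule.map_top,
      Submodule.range_subtype]
  -- The exponent `N` may depend on `n`; the ranks and the matrix `δ 0` do not.
  · obtain ⟨N, hN⟩ : ∃ N, maximalIdeal R ^ N ≤ J.map (iterateFrobenius R p n) := by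
      rw [← frobPower_eq_map]
      refine Ideal.exists_pow_le_of_le_radical_of_fg ?_ (IsNoetherian.noetherian _)
      rw [radical_frobPower, hJ]
    have hexact := exact_of_extVanishes (d := fun i => twistMap (iterateFrobenius R p n) (d i))
      (fun i => by
        rw [← twistMap_comp, (hex i).linearMap_comp_eq_zero, twistMap_zero]) hb₀ hdepth N
      (fun i v hv y hy => smul_mem_range_twistMap _ hex hJd i hv (hN hy)) 0 v
    have hv : ∀ i, twistMap (iterateFrobenius R p n) d₀ v i = ∑ j, g j ^ p ^ n * v j := fun i => by
      rw [twistMap_apply]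
      rfl
    refine Iff.trans ?_ hexact
    change _ ↔ twistMap (iterateFrobenius R p n) d₀ v = 0
    rw [funext_iff]
    simp [hv]

end FrobeniusExactness

/-! ### Artinian local rings of finite self-injective dimension. -/

section SelfInjective

open IsLocalRing Abelian

theorem nonempty_linearEquiv_of_isSimpleModule (R : Type u) [CommRing R] [IsLocalRing R]
    (S : Type u) [AddCommGroup S] [Module R S] [IsSimpleModule R S] :
    Nonempty (S ≃ₗ[R] R ⧸ maximalIdeal R) := by
  obtain ⟨I, hI, ⟨e⟩⟩ := isSimpleModule_iff_quot_maximal.mp ‹IsSimpleModule R S›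
  obtain rfl := eq_maximalIdeal hI
  exact ⟨e⟩

variable {A : Type u} [CommRing A] [IsLocalRing A] [IsArtinianRing A]

theorem exists_injective_of_isSimpleModule (S : Type u) [AddCommGroup S] [Module A S]
    [IsSimpleModule A S] : ∃ f : S →ₗ[A] A, Function.Injective f := by
  obtain ⟨T, hT⟩ := IsAtomic.exists_atom (Submodule A A)
  have := isSimpleModule_iff_isAtom.mpr hT
  obtain ⟨e⟩ := nonempty_linearEquiv_of_isSimpleModule A S
  obtain ⟨e'⟩ := nonempty_linearEquiv_of_isSimpleModule A T
  exact ⟨T.subtype ∘ₗ (e.trans e'.symm).toLinearMap,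
    T.subtype_injective.comp (e.trans e'.symm).injective⟩

/-- A simple module `S` embeds in `A`, so `Ext^{d+1}(S, A)` lies between `Ext^{d+1}(A, A) = 0` and
`Ext^{d+2}(A/S, A) = 0`. Finite length passes from simple modules to all finite ones. Iterating
brings the vanishing down to `Ext^1`, which is Baer's criterion. -/
theorem subsingleton_ext_of_subsingleton_ext_succ {d : ℕ}
    (h : ∀ (M : Type u) [AddCommGroup M] [Module A M] [Module.Finite A M],
      Subsingleton (Ext (ModuleCat.of A M) (ModuleCat.of A A) (d + 2)))
    (M : Type u) [AddCommGroup M] [Module A M] [Module.Finite A M] :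
    Subsingleton (Ext (ModuleCat.of A M) (ModuleCat.of A A) (d + 1)) := by
  have hfl : IsFiniteLength A M := isFiniteLength_iff_isNoetherian_isArtinian.mpr
    ⟨inferInstance, inferInstance⟩
  suffices H : ∀ x : Ext (ModuleCat.of A M) (ModuleCat.of A A) (d + 1), x = 0 from
    ⟨fun x y => by rw [H x, H y]⟩
  have hsimple : ∀ (S : Type u) [AddCommGroup S] [Module A S] [IsSimpleModule A S]
      (x : Ext (ModuleCat.of A S) (ModuleCat.of A A) (d + 1)), x = 0 := by
    intro S _ _ _ x
    obtain ⟨f, hf⟩ := exists_injective_of_isSimpleModule (A := A) S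
    obtain ⟨y, rfl⟩ := Ext.contravariant_sequence_exact₁ (shortExact_exactShortComplex
      (LinearMap.exact_map_mkQ_range f) hf (Submodule.mkQ_surjective _)) _ x
      (n₁ := d + 2) (by omega) ((h (A ⧸ LinearMap.range f)).elim _ _)
    have : Projective (ModuleCat.of A A) :=
      ModuleCat.projective_of_free (Module.Basis.singleton Unit A)
    have hy : y = 0 := Ext.eq_zero_of_projective (P := ModuleCat.of A A) y
    rw [hy, Ext.comp_zero]
  induction hfl with
  | of_subsingleton =>
    intro x
    rename_i M _ _ _
    have h0 : 𝟙 (ModuleCat.of A M) = 0 := (ModuleCat.isZero_of_subsingleton _).eq_of_src _ _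
    rw [← Ext.mk₀_id_comp x, h0, Ext.mk₀_zero, Ext.zero_comp]
  | of_simple_quotient _ ih =>
    intro x
    rename_i M _ _ N _ _
    obtain ⟨y, rfl⟩ := Ext.contravariant_sequence_exact₂ (shortExact_exactShortComplex
      (LinearMap.exact_subtype_mkQ N) N.subtype_injective N.mkQ_surjective) _ x (ih _)
    have hy : y = 0 := hsimple (M ⧸ N) y
    rw [hy, Ext.comp_zero]

/-- An Artinian local ring of finite self-injective dimension is self-injective. -/
theorem baer_self_of_injectiveDimension_ne_top
    (h : injectiveDimension (ModuleCat.of A A) ≠ ⊤) : Module.Baer A A := by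
  obtain ⟨n, hn⟩ := (injectiveDimension_ne_top_iff _).mp h
  have h1 : ∀ (M : Type u) [AddCommGroup M] [Module A M] [Module.Finite A M],
      Subsingleton (Ext (ModuleCat.of A M) (ModuleCat.of A A) 1) := by
    have h0 : ∀ (M : Type u) [AddCommGroup M] [Module A M] [Module.Finite A M],
        Subsingleton (Ext (ModuleCat.of A M) (ModuleCat.of A A) (n + 1)) := fun M _ _ _ =>
      HasInjectiveDimensionLT.subsingleton _ (n + 1) _ le_rfl _
    clear hn
    induction n with
    | zero => exact h0
    | succ n ih => exact ih fun M _ _ _ => subsingleton_ext_of_subsingleton_ext_succ h0 M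
  intro I g
  obtain ⟨y, hy⟩ := Ext.contravariant_sequence_exact₁ (shortExact_exactShortComplex
    (LinearMap.exact_subtype_mkQ I) I.subtype_injective I.mkQ_surjective) (ModuleCat.of A A)
    (Ext.mk₀ (ModuleCat.ofHom g)) (n₁ := 1) rfl ((h1 (A ⧸ I)).elim _ _)
  obtain ⟨φ, rfl⟩ := (Ext.mk₀_bijective _ _).2 y
  rw [Ext.mk₀_comp_mk₀] at hy
  have := (Ext.mk₀_bijective _ _).1 hy
  refine ⟨φ.hom, fun x hx => ?_⟩
  exact LinearMap.congr_fun (congrArg ModuleCat.Hom.hom this) ⟨x, hx⟩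

end SelfInjective

/-! ### Length-preserving duality into a self-injective Artinian quotient. -/

section Duality

open IsLocalRing

variable {R : Type u} [CommRing R] {𝔧 : Ideal R}

/-- Modules killed by `𝔧` are `R/𝔧`-modules with the same linear maps, so injectivity over `R/𝔧`
suffices. -/
theorem exists_extension_of_baer_quotient (h : Module.Baer (R ⧸ 𝔧) (R ⧸ 𝔧)) {M : Type u}
    [AddCommGroup M] [Module R M] (hM : Module.IsTorsionBySet R M 𝔧) (N : Submodule R M)
    (f : N →ₗ[R] R ⧸ 𝔧) : ∃ F : M →ₗ[R] R ⧸ 𝔧, F ∘ₗ N.subtype = f := by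
  have hN : Module.IsTorsionBySet R N 𝔧 := fun z a => Subtype.ext (@hM (z : M) a)
  let := hM.module
  let := hN.module
  have := hM.isScalarTower (S := R)
  have := hN.isScalarTower (S := R)
  have hs : Function.Surjective (algebraMap R (R ⧸ 𝔧)) := Ideal.Quotient.mk_surjective
  obtain ⟨F, hF⟩ := Module.Baer.extension_property h
    (N.subtype.extendScalarsOfSurjective hs) N.subtype_injective
    (f.extendScalarsOfSurjective hs)
  exact ⟨F.restrictScalars R, LinearMap.ext fun z => LinearMap.congr_fun hF z⟩

theorem isTorsionBySet_quotient_ideal (𝔧 : Ideal R) : Module.IsTorsionBySet R (R ⧸ 𝔧) 𝔧 :=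
  fun z a => by
    obtain ⟨r, rfl⟩ := Submodule.Quotient.mk_surjective _ z
    exact (Submodule.Quotient.mk_eq_zero 𝔧).mpr (Ideal.mul_mem_right r 𝔧 a.2)

variable [IsLocalRing R]

/-- By injectivity `Hom(-, R/𝔧)` is exact on modules killed by `𝔧`, and every simple factor is the
residue field. -/
theorem length_hom_eq_length_mul (h : Module.Baer (R ⧸ 𝔧) (R ⧸ 𝔧))
    {M : Type u} [AddCommGroup M] [Module R M]
    (hfl : IsFiniteLength R M) (hM : Module.IsTorsionBySet R M 𝔧) :
    Module.length R (M →ₗ[R] R ⧸ 𝔧) =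
      Module.length R M * Module.length R ((R ⧸ maximalIdeal R) →ₗ[R] R ⧸ 𝔧) := by
  induction hfl with
  | of_subsingleton => simp [Module.length_eq_zero]
  | of_simple_quotient _ ih =>
    rename_i M _ _ N _ _
    obtain ⟨e⟩ := nonempty_linearEquiv_of_isSimpleModule R (M ⧸ N)
    have hN : Module.IsTorsionBySet R N 𝔧 := fun z a => Subtype.ext (@hM (z : M) a)
    rw [Module.length_eq_add_of_exact (LinearMap.lcomp R (R ⧸ 𝔧) N.mkQ)
      (LinearMap.lcomp R (R ⧸ 𝔧) N.subtype), ih hN,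
      Module.length_eq_add_of_exact N.subtype N.mkQ N.subtype_injective N.mkQ_surjective
        (LinearMap.exact_subtype_mkQ N), Module.length_eq_one R (M ⧸ N),
      (LinearEquiv.congrLeft (R ⧸ 𝔧) R e).length_eq]
    · ring
    · exact fun φ ψ hφ => LinearMap.cancel_right N.mkQ_surjective |>.mp hφ
    · exact fun f => exists_extension_of_baer_quotient h hM N f
    · intro φ
      constructor
      · intro hφ
        refine ⟨N.liftQ φ fun z hz => LinearMap.congr_fun hφ ⟨z, hz⟩, LinearMap.ext fun z => rfl⟩
      · rintro ⟨ψ, rfl⟩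
        refine LinearMap.ext fun z => ?_
        change ψ (Submodule.Quotient.mk (z : M)) = 0
        rw [(Submodule.Quotient.mk_eq_zero N).mpr z.2, map_zero]

/-- The constant factor is found by taking `M = R/𝔧`: its endomorphism module is itself, of finite
nonzero length, so the factor is `1`. -/
theorem length_hom_eq (h : Module.Baer (R ⧸ 𝔧) (R ⧸ 𝔧))
    [IsNoetherianRing R] [IsArtinianRing (R ⧸ 𝔧)] [Nontrivial (R ⧸ 𝔧)]
    {M : Type u} [AddCommGroup M] [Module R M]
    (hfl : IsFiniteLength R M) (hM : Module.IsTorsionBySet R M 𝔧) :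
    Module.length R (M →ₗ[R] R ⧸ 𝔧) = Module.length R M := by
  have : IsArtinian R (R ⧸ 𝔧) :=
    isArtinian_of_surjective_algebraMap (M := R ⧸ 𝔧) (R := R ⧸ 𝔧) (S := R)
      Ideal.Quotient.mk_surjective
  have hD := Module.length_ne_top (R := R) (M := R ⧸ 𝔧)
  have hDt : Module.IsTorsionBySet R (R ⧸ 𝔧) 𝔧 := isTorsionBySet_quotient_ideal 𝔧
  have hself : Module.length R ((R ⧸ 𝔧) →ₗ[R] R ⧸ 𝔧) = Module.length R (R ⧸ 𝔧) := by
    refine (LinearEquiv.ofBijective (LinearMap.applyₗ (1 : R ⧸ 𝔧)) ⟨?_, ?_⟩).length_eq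
    · intro φ ψ hφ
      refine LinearMap.cancel_right (Submodule.mkQ_surjective 𝔧) |>.mp ?_
      exact LinearMap.ext_ring hφ
    · exact fun z => ⟨(LinearMap.mul R (R ⧸ 𝔧)).flip z, by simp⟩
  have hmul := length_hom_eq_length_mul h (isFiniteLength_iff_isNoetherian_isArtinian.mpr
    ⟨inferInstance, this⟩) hDt
  rw [hself] at hmul
  have hr : Module.length R ((R ⧸ maximalIdeal R) →ₗ[R] R ⧸ 𝔧) = 1 := by
    have h0 : Module.length R (R ⧸ 𝔧) ≠ 0 := Module.length_pos.ne'
    generalize Module.length R (R ⧸ 𝔧) = l at *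
    generalize Module.length R ((R ⧸ maximalIdeal R) →ₗ[R] R ⧸ 𝔧) = r at *
    lift l to ℕ using hD
    cases r with
    | top =>
      rw [ENat.mul_top h0] at hmul
      exact absurd hmul (ENat.natCast_ne_top l)
    | coe r =>
      norm_cast at hmul h0 ⊢
      exact (Nat.mul_eq_left h0).mp hmul.symm
  rw [length_hom_eq_length_mul h hfl hM, hr, mul_one]

/-- Over a Noetherian local ring with an Artinian self-injective quotient `D = R/𝔧`, the module
`Hom(R/𝔟, D/yD)` and its dual `R/𝔟 ⊗ (0 :_D y)` have the same length. -/
theorem length_hom_quotient_sup_span (h : Module.Baer (R ⧸ 𝔧) (R ⧸ 𝔧))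
    [IsNoetherianRing R] [IsArtinianRing (R ⧸ 𝔧)]
    [Nontrivial (R ⧸ 𝔧)] (y : R) (𝔟 : Ideal R) :
    Module.length R ((R ⧸ 𝔟) →ₗ[R] (R ⧸ (𝔧 ⊔ Ideal.span {y}))) =
      Module.length R (Submodule.torsionBy R (R ⧸ 𝔧) y ⊗[R] (R ⧸ 𝔟)) := by
  have : IsArtinian R (R ⧸ 𝔧) :=
    isArtinian_of_surjective_algebraMap (M := R ⧸ 𝔧) (R := R ⧸ 𝔧) (S := R)
      Ideal.Quotient.mk_surjective
  have hDt : Module.IsTorsionBySet R (R ⧸ 𝔧) 𝔧 := isTorsionBySet_quotient_ideal 𝔧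
  set N := Submodule.torsionBy R (R ⧸ 𝔧) y with hN
  set Q := R ⧸ (𝔧 ⊔ Ideal.span {y}) with hQ
  have hNt : Module.IsTorsionBySet R N 𝔧 := fun z a => Subtype.ext (@hDt z a)
  let π : (R ⧸ 𝔧) →ₗ[R] Q := Submodule.factor le_sup_left
  have hπ : Function.Surjective π := Submodule.factor_surjective _
  have hQt : Module.IsTorsionBySet R Q 𝔧 := fun z a => by
    obtain ⟨w, rfl⟩ := hπ z
    rw [← map_smul, @hDt w a, map_zero]
  have : IsArtinian R Q := isArtinian_of_surjective _ π hπ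
  have hQfl : IsFiniteLength R Q := isFiniteLength_iff_isNoetherian_isArtinian.mpr
    ⟨inferInstance, inferInstance⟩
  have hNfl : IsFiniteLength R N := isFiniteLength_iff_isNoetherian_isArtinian.mpr
    ⟨inferInstance, inferInstance⟩
  have hQN : Module.length R Q ≤ Module.length R N := by
    -- A map `Q → R/𝔧` is determined by the image of `1`, which is killed by `y`.
    rw [← length_hom_eq h hQfl hQt]
    let ev : (Q →ₗ[R] R ⧸ 𝔧) →ₗ[R] N :=
      (LinearMap.applyₗ (R := R) (M₂ := R ⧸ 𝔧) (Submodule.Quotient.mk 1 : Q)).codRestrict N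
        fun φ => by
          rw [hN, Submodule.mem_torsionBy_iff, LinearMap.applyₗ_apply_apply, ← map_smul]
          have : y • (Submodule.Quotient.mk 1 : Q) = 0 :=
            (Submodule.Quotient.mk_eq_zero _).mpr (Ideal.mem_sup_right
              (Ideal.mem_span_singleton.mpr ⟨1, rfl⟩))
          rw [this, map_zero]
    refine Module.length_le_of_injective ev fun φ ψ hφ => ?_
    refine LinearMap.cancel_right (Submodule.mkQ_surjective _) |>.mp ?_
    exact LinearMap.ext_ring (congrArg Subtype.val hφ)
  -- Scaling the inclusion of `N` induces `Q → Hom(N, R/𝔧)`. It is onto because maps from `N` extend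
  -- to `R/𝔧`, and the length inequality `hQN` then makes it injective.
  let μ : R →ₗ[R] (N →ₗ[R] R ⧸ 𝔧) := LinearMap.toSpanSingleton R _ N.subtype
  let ψ : Q →ₗ[R] (N →ₗ[R] R ⧸ 𝔧) := Submodule.liftQ _ μ (by
    refine sup_le (fun a ha => ?_) ((Ideal.span_singleton_le_iff_mem _).mpr ?_)
    · refine LinearMap.ext fun z => @hDt (z : R ⧸ 𝔧) ⟨a, ha⟩
    · exact LinearMap.ext fun z => z.2)
  have hψ : Function.Surjective ψ := by
    intro φ
    obtain ⟨F, hF⟩ := exists_extension_of_baer_quotient h hDt N φ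
    obtain ⟨r, hr⟩ := Submodule.Quotient.mk_surjective _ (F (Submodule.Quotient.mk 1))
    refine ⟨Submodule.Quotient.mk r, LinearMap.ext fun z => ?_⟩
    obtain ⟨w, hw⟩ := Submodule.Quotient.mk_surjective _ (z : R ⧸ 𝔧)
    have h1 : φ z = w • F (Submodule.Quotient.mk 1) := by
      rw [← hF, ← map_smul, LinearMap.comp_apply, Submodule.subtype_apply, ← hw]
      congr 1
      exact congrArg _ (mul_one w).symm
    rw [h1, ← hr]
    change r • (z : R ⧸ 𝔧) = _
    rw [← hw]
    exact congrArg (Submodule.Quotient.mk (p := 𝔧)) (mul_comm r w)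
  have hψi : Function.Injective ψ := by
    rw [← LinearMap.ker_eq_bot, ← Submodule.subsingleton_iff_eq_bot,
      ← Module.length_eq_zero_iff (R := R)]
    have h1 := Module.length_eq_add_of_exact (LinearMap.ker ψ).subtype ψ
      (Submodule.subtype_injective _) hψ ψ.exact_subtype_ker_map
    rw [length_hom_eq h hNfl hNt] at h1
    have h2 := Module.length_ne_top (R := R) (M := N)
    rw [h1] at hQN
    have h3 : Module.length R (LinearMap.ker ψ) + Module.length R N ≤ 0 + Module.length R N := by
      rwa [zero_add]
    exact nonpos_iff_eq_zero.mp ((ENat.add_le_add_iff_right h2).mp h3)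
  have hT : Module.IsTorsionBySet R (N ⊗[R] (R ⧸ 𝔟)) 𝔧 := fun z a => by
    induction z with
    | zero => simp
    | add z w hz hw => rw [smul_add, hz, hw, add_zero]
    | tmul z w => rw [TensorProduct.smul_tmul', @hNt z a, TensorProduct.zero_tmul]
  have hTfl : IsFiniteLength R (N ⊗[R] (R ⧸ 𝔟)) := by
    have hs : Function.Surjective ((TensorProduct.mk R N (R ⧸ 𝔟)).flip (Submodule.Quotient.mk 1)) := by
      intro z
      induction z with
      | zero => exact ⟨0, map_zero _⟩
      | add z w hz hw =>
        obtain ⟨z, rfl⟩ := hz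
        obtain ⟨w, rfl⟩ := hw
        exact ⟨z + w, map_add _ _ _⟩
      | tmul z w =>
        obtain ⟨r, rfl⟩ := Submodule.Quotient.mk_surjective _ w
        refine ⟨r • z, ?_⟩
        rw [LinearMap.flip_apply, TensorProduct.mk_apply, TensorProduct.smul_tmul]
        congr 1
        exact congrArg _ (mul_one r)
    exact isFiniteLength_iff_isNoetherian_isArtinian.mpr
      ⟨isNoetherian_of_surjective _ (LinearMap.range_eq_top.mpr hs),
        isArtinian_of_surjective _ _ hs⟩
  rw [← length_hom_eq h hTfl hT]
  exact ((LinearEquiv.congrRight (LinearEquiv.ofBijective ψ ⟨hψi, hψ⟩)).trans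
    ((TensorProduct.lift.equiv (RingHom.id R) (R ⧸ 𝔟) N (R ⧸ 𝔧)).trans
      (LinearEquiv.congrLeft _ R (TensorProduct.comm R _ _)))).length_eq

end Duality

/-! ### The long exact sequence of Tor in the first variable. -/

section TorSequence

open MonoidalCategory

variable (R : Type u) [CommRing R]

/-- The complex `M ⊗ P` for a projective resolution `P` of `N`. -/
abbrev tensorResolution (N : Type u) [AddCommGroup N] [Module R N] (M : ModuleCat.{u} R) :
    ChainComplex (ModuleCat.{u} R) ℕ :=
  (((tensoringLeft (ModuleCat.{u} R)).obj M).mapHomologicalComplex _).obj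
    (projectiveResolution (ModuleCat.of R N)).complex

/-- `Tor` as the homology of `tensorResolution`. -/
def torIsoHomology (i : ℕ) (M N : Type u) [AddCommGroup M] [Module R M] [AddCommGroup N]
    [Module R N] :
    torModule R i M N ≅ (tensorResolution R N (ModuleCat.of R M)).homology i :=
  (projectiveResolution (ModuleCat.of R N)).isoLeftDerivedObj
    ((tensoringLeft (ModuleCat.{u} R)).obj (ModuleCat.of R M)) i

variable {R} {A B C : Type u} [AddCommGroup A] [Module R A] [AddCommGroup B] [Module R B]
  [AddCommGroup C] [Module R C] {f : A →ₗ[R] B} {g : B →ₗ[R] C}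
  (N : Type u) [AddCommGroup N] [Module R N]

/-- The short complex of complexes obtained by tensoring a short complex with a projective
resolution. -/
def tensorShortComplex (h : Function.Exact f g) :
    ShortComplex (ChainComplex (ModuleCat.{u} R) ℕ) where
  X₁ := tensorResolution R N (ModuleCat.of R A)
  X₂ := tensorResolution R N (ModuleCat.of R B)
  X₃ := tensorResolution R N (ModuleCat.of R C)
  f := (NatTrans.mapHomologicalComplex
    ((tensoringLeft (ModuleCat.{u} R)).map (ModuleCat.ofHom f)) _).app _
  g := (NatTrans.mapHomologicalComplex
    ((tensoringLeft (ModuleCat.{u} R)).map (ModuleCat.ofHom g)) _).app _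
  zero := by
    ext i : 1
    have : ModuleCat.ofHom f ≫ ModuleCat.ofHom g = 0 := by
      rw [← ModuleCat.ofHom_comp, h.linearMap_comp_eq_zero]; rfl
    change ModuleCat.ofHom f ▷ _ ≫ ModuleCat.ofHom g ▷ _ = 0
    rw [← comp_whiskerRight, this]
    exact MonoidalPreadditive.zero_whiskerRight

theorem shortExact_tensorShortComplex (h : Function.Exact f g) (hf : Function.Injective f)
    (hg : Function.Surjective g) : (tensorShortComplex N h).ShortExact := by
  refine HomologicalComplex.shortExact_of_degreewise_shortExact _ fun i => ?_
  let P := (projectiveResolution (ModuleCat.of R N)).complex.X i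
  have : Module.Projective R P := (IsProjective.iff_projective P).mpr
    ((projectiveResolution (ModuleCat.of R N)).projective i)
  refine ModuleCat.shortComplex_shortExact _ ?_ ?_ ?_
  · exact rTensor_exact P h hg
  · exact Module.Flat.rTensor_preserves_injective_linearMap f hf
  · exact LinearMap.rTensor_surjective P hg

/-- The long exact sequence of `Tor` in the first variable. -/
theorem exists_torModule_exact (h : Function.Exact f g) (hf : Function.Injective f)
    (hg : Function.Surjective g) :
    ∃ (α : ∀ i, torModule R i A N →ₗ[R] torModule R i B N)
      (β : ∀ i, torModule R i B N →ₗ[R] torModule R i C N)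
      (δ : ∀ i, torModule R (i + 1) C N →ₗ[R] torModule R i A N),
      (∀ i, Function.Exact (α i) (β i)) ∧ (∀ i, Function.Exact (β (i + 1)) (δ i)) ∧
      (∀ i, Function.Exact (δ i) (α i)) ∧ Function.Surjective (β 0) := by
  have hS := shortExact_tensorShortComplex N h hf hg
  let eA := fun i => (torIsoHomology R i A N).toLinearEquiv
  let eB := fun i => (torIsoHomology R i B N).toLinearEquiv
  let eC := fun i => (torIsoHomology R i C N).toLinearEquiv
  let α := fun i => (HomologicalComplex.homologyMap (tensorShortComplex N h).f i).hom
  let β := fun i => (HomologicalComplex.homologyMap (tensorShortComplex N h).g i).hom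
  let δ := fun i => (hS.δ (i + 1) i rfl).hom
  have h1 : ∀ i, Function.Exact (α i) (β i) := fun i =>
    (ShortComplex.ShortExact.moduleCat_exact_iff_function_exact _).mp (hS.homology_exact₂ i)
  have h2 : ∀ i, Function.Exact (β (i + 1)) (δ i) := fun i =>
    (ShortComplex.ShortExact.moduleCat_exact_iff_function_exact _).mp
      (hS.homology_exact₃ (i + 1) i rfl)
  have h3 : ∀ i, Function.Exact (δ i) (α i) := fun i =>
    (ShortComplex.ShortExact.moduleCat_exact_iff_function_exact _).mp
      (hS.homology_exact₁ (i + 1) i rfl)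
  have h4 : Function.Surjective (β 0) := by
    have := hS.epi_g
    have : Epi (HomologicalComplex.homologyMap (tensorShortComplex N h).g 0) :=
      HomologicalComplex.epi_homologyMap_of_epi_of_not_rel _ _ (by simp)
    exact (ModuleCat.epi_iff_surjective _).mp this
  refine ⟨fun i => (eB i).symm.toLinearMap ∘ₗ α i ∘ₗ (eA i).toLinearMap,
    fun i => (eC i).symm.toLinearMap ∘ₗ β i ∘ₗ (eB i).toLinearMap,
    fun i => (eA i).symm.toLinearMap ∘ₗ δ i ∘ₗ (eC (i + 1)).toLinearMap, ?_, ?_, ?_, ?_⟩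
  · intro i
    refine (Function.Exact.iff_of_ladder_linearEquiv (e₁ := eA i) (e₂ := eB i) (e₃ := eC i)
      ?_ ?_).mp (h1 i) <;> ext <;> simp <;> rfl
  · intro i
    refine (Function.Exact.iff_of_ladder_linearEquiv (e₁ := eB (i + 1)) (e₂ := eC (i + 1))
      (e₃ := eA i) ?_ ?_).mp (h2 i) <;> ext <;> simp <;> rfl
  · intro i
    refine (Function.Exact.iff_of_ladder_linearEquiv (e₁ := eC (i + 1)) (e₂ := eA i)
      (e₃ := eB i) ?_ ?_).mp (h3 i) <;> ext <;> simp <;> rfl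
  · exact (eC 0).symm.surjective.comp (h4.comp (eB 0).surjective)

theorem subsingleton_torModule_of_flat [Module.Flat R A] (i : ℕ) :
    Subsingleton (torModule R (i + 1) A N) := by
  refine (torIsoHomology R (i + 1) A N).toLinearEquiv.toEquiv.subsingleton_congr.mpr ?_
  refine ModuleCat.isZero_iff_subsingleton.mp ?_
  rw [← HomologicalComplex.exactAt_iff_isZero_homology,
    HomologicalComplex.exactAt_iff' _ (i + 2) (i + 1) i (by simp) (by simp),
    ShortComplex.ShortExact.moduleCat_exact_iff_function_exact]
  have := (ShortComplex.ShortExact.moduleCat_exact_iff_function_exact _).mp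
    ((projectiveResolution (ModuleCat.of R N)).exact_succ i)
  exact Module.Flat.lTensor_exact A this

/-- `Tor_0` is the tensor product. -/
def torModuleZeroEquiv (A : Type u) [AddCommGroup A] [Module R A] :
    torModule R 0 A N ≃ₗ[R] A ⊗[R] N :=
  (((tensoringLeft (ModuleCat.{u} R)).obj (ModuleCat.of R A)).leftDerivedZeroIsoSelf.app
    (ModuleCat.of R N)).toLinearEquiv

end TorSequence

/-! ### Length bounds for Tor and the colon sequence. -/

section LengthEstimates

variable {R : Type u} [CommRing R] {A B C : Type u} [AddCommGroup A] [Module R A]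
  [AddCommGroup B] [Module R B] [AddCommGroup C] [Module R C] {f : A →ₗ[R] B} {g : B →ₗ[R] C}

theorem length_le_add_of_exact (h : Function.Exact f g) :
    Module.length R B ≤ Module.length R A + Module.length R C := by
  rw [Module.length_eq_add_of_exact (LinearMap.ker g).subtype g.rangeRestrict
    (Submodule.subtype_injective _) g.surjective_rangeRestrict (by
      rw [LinearMap.exact_iff, LinearMap.ker_rangeRestrict, Submodule.range_subtype]),
    LinearMap.exact_iff.mp h]
  exact add_le_add (Module.length_le_of_surjective f.rangeRestrict f.surjective_rangeRestrict)
    (Module.length_le_of_injective _ (Submodule.subtype_injective _))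

theorem injective_of_surjective_of_length_le (hB : Module.length R C ≠ ⊤)
    (hg : Function.Surjective g) (hle : Module.length R B ≤ Module.length R C) :
    Function.Injective g := by
  rw [← LinearMap.ker_eq_bot, ← Submodule.subsingleton_iff_eq_bot,
    ← Module.length_eq_zero_iff (R := R)]
  have h1 := Module.length_eq_add_of_exact (LinearMap.ker g).subtype g
    (Submodule.subtype_injective _) hg g.exact_subtype_ker_map
  rw [h1] at hle
  have h3 : Module.length R (LinearMap.ker g) + Module.length R C ≤ 0 + Module.length R C := by
    rwa [zero_add]
  exact nonpos_iff_eq_zero.mp ((ENat.add_le_add_iff_right hB).mp h3)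

variable (N : Type u) [AddCommGroup N] [Module R N]

theorem length_torModule_zero (A : Type u) [AddCommGroup A] [Module R A] :
    Module.length R (torModule R 0 A N) = Module.length R (A ⊗[R] N) :=
  (torModuleZeroEquiv N A).length_eq

theorem length_torModule_succ_of_flat (A : Type u) [AddCommGroup A] [Module R A] [Module.Flat R A]
    (i : ℕ) : Module.length R (torModule R (i + 1) A N) = 0 :=
  Module.length_eq_zero_iff.mpr (subsingleton_torModule_of_flat N i)

theorem length_torModule_succ_right_le (h : Function.Exact f g) (hf : Function.Injective f)
    (hg : Function.Surjective g) (i : ℕ) :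
    Module.length R (torModule R (i + 1) C N) ≤
      Module.length R (torModule R (i + 1) B N) + Module.length R (torModule R i A N) := by
  obtain ⟨α, β, δ, -, h2, -, -⟩ := exists_torModule_exact N h hf hg
  exact length_le_add_of_exact (h2 i)

theorem length_torModule_left_le (h : Function.Exact f g) (hf : Function.Injective f)
    (hg : Function.Surjective g) (i : ℕ) :
    Module.length R (torModule R i A N) ≤
      Module.length R (torModule R (i + 1) C N) + Module.length R (torModule R i B N) := by
  obtain ⟨α, β, δ, -, -, h3, -⟩ := exists_torModule_exact N h hf hg
  exact length_le_add_of_exact (h3 i)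

theorem length_tensor_le_of_surjective (hg : Function.Surjective g) :
    Module.length R (C ⊗[R] N) ≤ Module.length R (B ⊗[R] N) :=
  Module.length_le_of_surjective (g.rTensor N) (LinearMap.rTensor_surjective N hg)

theorem length_tensor_le_add (h : Function.Exact f g) (hg : Function.Surjective g) :
    Module.length R (B ⊗[R] N) ≤ Module.length R (A ⊗[R] N) + Module.length R (C ⊗[R] N) :=
  length_le_add_of_exact (rTensor_exact N h hg)

theorem length_pi_tensor (m : ℕ) :
    Module.length R ((Fin m → R) ⊗[R] N) = m * Module.length R N := by
  rw [((TensorProduct.comm R _ _).trans (TensorProduct.piScalarRight R R N (Fin m))).length_eq,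
    Module.length_pi, ENat.card_eq_coe_fintype_card, Fintype.card_fin]

theorem length_tensor_le_of_span {m : ℕ} (φ : (Fin m → R) →ₗ[R] A)
    (hφ : Function.Surjective φ) : Module.length R (A ⊗[R] N) ≤ m * Module.length R N :=
  (length_tensor_le_of_surjective N hφ).trans (length_pi_tensor N m).le

theorem length_tensor_ne_top [Module.Finite R A] (hN : Module.length R N ≠ ⊤) :
    Module.length R (A ⊗[R] N) ≠ ⊤ := by
  obtain ⟨m, φ, hφ⟩ := Module.Finite.exists_fin' R A
  exact ne_top_of_le_ne_top (WithTop.mul_ne_top (ENat.natCast_ne_top m) hN)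
    (length_tensor_le_of_span N φ hφ)

theorem length_torModule_one_quotient_le (L : Ideal R) :
    Module.length R (torModule R 1 (R ⧸ L) N) ≤ Module.length R (L ⊗[R] N) := by
  have := length_torModule_succ_right_le N (LinearMap.exact_subtype_mkQ L) L.subtype_injective
    L.mkQ_surjective 0
  rwa [length_torModule_succ_of_flat N R, zero_add (Module.length R _), length_torModule_zero] at this

theorem length_ideal_tensor_le (L : Ideal R) :
    Module.length R (L ⊗[R] N) ≤ Module.length R (torModule R 1 (R ⧸ L) N) +
      Module.length R N := by
  have := length_torModule_left_le N (LinearMap.exact_subtype_mkQ L) L.subtype_injective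
    L.mkQ_surjective 0
  rwa [length_torModule_zero, length_torModule_zero,
    (TensorProduct.lid R N).length_eq] at this

/-- `Tor_1(A, N)` embeds in `im ψ ⊗ N`. The bound depends only on the number of relations, which
makes it uniform over the ideals `J^[q]`. -/
theorem length_torModule_one_le_of_presentation {l m : ℕ} {ψ : (Fin l → R) →ₗ[R] (Fin m → R)}
    {φ : (Fin m → R) →ₗ[R] A} (h : Function.Exact ψ φ) (hφ : Function.Surjective φ) :
    Module.length R (torModule R 1 A N) ≤ l * Module.length R N := by
  have hex : Function.Exact (LinearMap.range ψ).subtype φ := by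
    rw [LinearMap.exact_iff, Submodule.range_subtype]
    exact LinearMap.exact_iff.mp h
  have := length_torModule_succ_right_le N hex (Submodule.subtype_injective _) hφ 0
  rw [length_torModule_succ_of_flat N (Fin m → R), zero_add (Module.length R _), length_torModule_zero] at this
  exact this.trans (length_tensor_le_of_span N ψ.rangeRestrict ψ.surjective_rangeRestrict)

theorem length_torModule_two_quotient_le (L : Ideal R) :
    Module.length R (torModule R 2 (R ⧸ L) N) ≤ Module.length R (torModule R 1 L N) := by
  have := length_torModule_succ_right_le N (LinearMap.exact_subtype_mkQ L) L.subtype_injective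
    L.mkQ_surjective 1
  rwa [length_torModule_succ_of_flat N R, zero_add] at this

theorem length_torModule_two_quotient_ne_top [IsNoetherianRing R] (hN : Module.length R N ≠ ⊤)
    (L : Ideal R) : Module.length R (torModule R 2 (R ⧸ L) N) ≠ ⊤ := by
  obtain ⟨m, φ, hφ⟩ := Module.Finite.exists_fin' R L
  obtain ⟨l, ψ, hψ⟩ := Module.Finite.exists_fin' R (LinearMap.ker φ)
  have hex : Function.Exact ((LinearMap.ker φ).subtype ∘ₗ ψ) φ := by
    rw [LinearMap.exact_iff, LinearMap.range_comp, LinearMap.range_eq_top.mpr hψ,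
      Submodule.map_top, Submodule.range_subtype]
  exact ne_top_of_le_ne_top (WithTop.mul_ne_top (ENat.natCast_ne_top l) hN)
    ((length_torModule_two_quotient_le N L).trans
      (length_torModule_one_le_of_presentation N hex hφ))

/-- The map `R/(𝔧 : y) → R/𝔧` given by multiplication by `y`. -/
def colonQuotientMap (𝔧 : Ideal R) (y : R) :
    (R ⧸ Submodule.comap (LinearMap.mulRight R y) 𝔧) →ₗ[R] R ⧸ 𝔧 :=
  Submodule.mapQ _ _ (LinearMap.mulRight R y) le_rfl

theorem colonQuotientMap_injective (𝔧 : Ideal R) (y : R) :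
    Function.Injective (colonQuotientMap 𝔧 y) := by
  rw [← LinearMap.ker_eq_bot, colonQuotientMap, Submodule.ker_mapQ]
  exact Submodule.mkQ_map_self _

theorem colonQuotientMap_exact (𝔧 : Ideal R) (y : R) : Function.Exact (colonQuotientMap 𝔧 y)
    (Submodule.factor le_sup_left : (R ⧸ 𝔧) →ₗ[R] R ⧸ (𝔧 ⊔ Ideal.span {y})) := by
  intro z
  obtain ⟨r, rfl⟩ := Submodule.Quotient.mk_surjective _ z
  have h1 : (Submodule.factor le_sup_left : (R ⧸ 𝔧) →ₗ[R] R ⧸ (𝔧 ⊔ Ideal.span {y}))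
      (Submodule.Quotient.mk r) = Submodule.Quotient.mk r := rfl
  rw [h1]
  refine (Submodule.Quotient.mk_eq_zero _).trans ⟨fun hr => ?_, ?_⟩
  · obtain ⟨a, ha, b, hb, rfl⟩ := Submodule.mem_sup.mp hr
    obtain ⟨c, rfl⟩ := Ideal.mem_span_singleton'.mp hb
    refine ⟨Submodule.Quotient.mk c, (Submodule.Quotient.eq 𝔧).mpr ?_⟩
    change c * y - (a + c * y) ∈ 𝔧
    rw [sub_add_cancel_right]
    exact 𝔧.neg_mem ha
  · rintro ⟨w, hw⟩
    obtain ⟨c, rfl⟩ := Submodule.Quotient.mk_surjective _ w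
    have : c * y - r ∈ 𝔧 := (Submodule.Quotient.eq 𝔧).mp hw
    have h2 : r = -(c * y - r) + c * y := by ring
    rw [h2]
    exact Submodule.add_mem_sup (𝔧.neg_mem this) (Ideal.mul_mem_left _ c
      (Ideal.mem_span_singleton_self y))

/-- From `Tor_2(R/𝔧) → Tor_2(R/(𝔧 + yR)) → Tor_1(R/(𝔧 : y))`, the outer terms being bounded by
dimension shifting. -/
theorem length_torModule_two_sup_le (𝔧 : Ideal R) (y : R) :
    Module.length R (torModule R 2 (R ⧸ (𝔧 ⊔ Ideal.span {y})) N) ≤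
      Module.length R (torModule R 1 𝔧 N) +
        Module.length R (Submodule.comap (LinearMap.mulRight R y) 𝔧 ⊗[R] N) :=
  (length_torModule_succ_right_le N (colonQuotientMap_exact 𝔧 y) (colonQuotientMap_injective 𝔧 y)
    (Submodule.factor_surjective _) 1).trans
    (add_le_add (length_torModule_two_quotient_le N 𝔧) (length_torModule_one_quotient_le N _))

/-- The converse estimate continues the same sequence to `Tor_1(R/𝔧)`; the summand `N` accounts for
the passage from `(𝔧 : y) ⊗ N` to `Tor_1(R/(𝔧 : y), N)`. -/
theorem length_colon_tensor_le (𝔧 : Ideal R) (y : R) :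
    Module.length R (Submodule.comap (LinearMap.mulRight R y) 𝔧 ⊗[R] N) ≤
      Module.length R (torModule R 2 (R ⧸ (𝔧 ⊔ Ideal.span {y})) N) +
        Module.length R (𝔧 ⊗[R] N) + Module.length R N :=
  (length_ideal_tensor_le N _).trans (add_le_add_left
    ((length_torModule_left_le N (colonQuotientMap_exact 𝔧 y) (colonQuotientMap_injective 𝔧 y)
      (Submodule.factor_surjective _) 1).trans
      (add_le_add_right (length_torModule_one_quotient_le N 𝔧) _)) _)

end LengthEstimates

/-! ### Betti numbers as lengths of Tor, and the socle as a Hom module. -/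

section Betti

open IsLocalRing

variable {R : Type u} [CommRing R] [IsLocalRing R] {M : Type u} [AddCommGroup M] [Module R M]
  {b : ℕ → ℕ} {d : ∀ i, (Fin (b (i + 1)) → R) →ₗ[R] (Fin (b i) → R)}
  {ε : (Fin (b 0) → R) →ₗ[R] M}

theorem length_residueField : Module.length R (R ⧸ maximalIdeal R) = 1 := by
  have : IsSimpleModule R (R ⧸ maximalIdeal R) :=
    isSimpleModule_iff_quot_maximal.mpr ⟨_, inferInstance, ⟨LinearEquiv.refl _ _⟩⟩
  exact Module.length_eq_one R _

theorem rTensor_subtype_ker_eq_zero (h : IsMinimalFreeResolution R M b d ε) :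
    (LinearMap.ker ε).subtype.rTensor (R ⧸ maximalIdeal R) = 0 := by
  refine TensorProduct.ext' fun z w => ?_
  have hz : (z : Fin (b 0) → R) ∈ maximalIdeal R • (⊤ : Submodule R (Fin (b 0) → R)) :=
    h.minimal 0 (LinearMap.exact_iff.mp h.exact_zero ▸ z.2)
  rw [LinearMap.rTensor_tmul, LinearMap.zero_apply, Submodule.subtype_apply]
  refine Submodule.smul_induction_on hz (fun r hr v _ => ?_) fun v v' hv hv' => ?_
  · rw [TensorProduct.smul_tmul]
    have : r • w = 0 := @isTorsionBySet_quotient_ideal R _ (maximalIdeal R) w ⟨r, hr⟩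
    rw [this, TensorProduct.tmul_zero]
  · rw [TensorProduct.add_tmul, hv, hv', add_zero]

theorem IsMinimalFreeResolution.length_tensor (h : IsMinimalFreeResolution R M b d ε) :
    Module.length R (M ⊗[R] (R ⧸ maximalIdeal R)) = b 0 := by
  have hex := rTensor_exact (R ⧸ maximalIdeal R) ε.exact_subtype_ker_map h.surjective
  rw [rTensor_subtype_ker_eq_zero h] at hex
  have hinj : Function.Injective (ε.rTensor (R ⧸ maximalIdeal R)) := by
    refine LinearMap.ker_eq_bot.mp ((LinearMap.exact_iff.mp hex).trans ?_)
    exact LinearMap.range_eq_bot.mpr rfl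
  have := (LinearEquiv.ofBijective _
    ⟨hinj, LinearMap.rTensor_surjective (R ⧸ maximalIdeal R) h.surjective⟩).length_eq
  rw [← this, length_pi_tensor, length_residueField, mul_one]

theorem IsMinimalFreeResolution.length_torModule_one (h : IsMinimalFreeResolution R M b d ε) :
    Module.length R (torModule R 1 M (R ⧸ maximalIdeal R)) = b 1 := by
  obtain ⟨α, β, δ, h1, h2, h3, h4⟩ := exists_torModule_exact (R ⧸ maximalIdeal R)
    ε.exact_subtype_ker_map (Submodule.subtype_injective _) h.surjective
  have hF := length_torModule_zero (R := R) (R ⧸ maximalIdeal R) (Fin (b 0) → R)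
  rw [length_pi_tensor, length_residueField, mul_one] at hF
  have hM := length_torModule_zero (R := R) (R ⧸ maximalIdeal R) M
  rw [h.length_tensor] at hM
  -- Both sides have length `b 0`, so the surjection `F_0 ⊗ k → M ⊗ k` is bijective and `Tor_1(M,
  -- k)` is all of `ker ε ⊗ k`.
  have hβ : Function.Injective (β 0) :=
    injective_of_surjective_of_length_le (by rw [hM]; exact ENat.natCast_ne_top _) h4
      (by rw [hM, hF])
  have hα : ∀ z, α 0 z = 0 := fun z => hβ (by rw [(h1 0).apply_apply_eq_zero, map_zero])
  have hδ : Function.Surjective (δ 0) := fun z => (h3 0 z).mp (hα z)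
  have hδ' : Function.Injective (δ 0) := by
    rw [← LinearMap.ker_eq_bot, LinearMap.exact_iff.mp (h2 0), LinearMap.range_eq_bot]
    have := subsingleton_torModule_of_flat (R := R) (A := Fin (b 0) → R) (R ⧸ maximalIdeal R) 0
    exact LinearMap.ext fun z => by rw [Subsingleton.elim z 0, map_zero, map_zero]
  rw [(LinearEquiv.ofBijective (δ 0) ⟨hδ', hδ⟩).length_eq, length_torModule_zero,
    h.tail.length_tensor]

theorem IsMinimalFreeResolution.length_torModule_two (h : IsMinimalFreeResolution R M b d ε) :
    Module.length R (torModule R 2 M (R ⧸ maximalIdeal R)) = b 2 := by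
  have h1 := length_torModule_succ_right_le (R ⧸ maximalIdeal R)
    ε.exact_subtype_ker_map (Submodule.subtype_injective _) h.surjective 1
  have h2 := length_torModule_left_le (R ⧸ maximalIdeal R)
    ε.exact_subtype_ker_map (Submodule.subtype_injective _) h.surjective 1
  rw [length_torModule_succ_of_flat _ (Fin (b 0) → R), zero_add, h.tail.length_torModule_one] at h1
  rw [length_torModule_succ_of_flat _ (Fin (b 0) → R), add_zero, h.tail.length_torModule_one] at h2
  exact le_antisymm h1 h2

/-- The infimum is attained by some minimal resolution, and each one has second rank equal to the
length of `Tor_2`. -/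
theorem bettiNumber_two_eq_length [IsNoetherianRing R] [Module.Finite R M] :
    (bettiNumber R M 2 : ℕ∞) = Module.length R (torModule R 2 M (R ⧸ maximalIdeal R)) := by
  obtain ⟨b, d, ε, h⟩ := exists_isMinimalFreeResolution (R := R) M
  obtain ⟨b', d', ε', h', heq⟩ :=
    Nat.sInf_mem (s := {r | ∃ b d ε, IsMinimalFreeResolution R M b d ε ∧ r = b 2})
      ⟨b 2, b, d, ε, h, rfl⟩
  rw [h'.length_torModule_two, bettiNumber, heq]

theorem length_socle : Module.length R (socle R M) =
    Module.length R ((R ⧸ maximalIdeal R) →ₗ[R] M) := by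
  let ev : ((R ⧸ maximalIdeal R) →ₗ[R] M) →ₗ[R] socle R M :=
    (LinearMap.applyₗ (R := R) (M₂ := M)
      (Submodule.Quotient.mk 1 : R ⧸ maximalIdeal R)).codRestrict (socle R M) fun φ => by
        refine (Submodule.mem_torsionBySet_iff _ _).mpr fun a => ?_
        rw [LinearMap.applyₗ_apply_apply, ← map_smul,
          @isTorsionBySet_quotient_ideal R _ (maximalIdeal R) _ a, map_zero]
  refine (LinearEquiv.ofBijective ev ⟨fun φ ψ hφ => ?_, fun z => ?_⟩).length_eq.symm
  · refine LinearMap.cancel_right (Submodule.mkQ_surjective _) |>.mp ?_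
    exact LinearMap.ext_ring (congrArg Subtype.val hφ)
  · refine ⟨(maximalIdeal R).liftQ (LinearMap.toSpanSingleton R M z) fun r hr =>
      (Submodule.mem_torsionBySet_iff _ _).mp z.2 ⟨r, hr⟩, Subtype.ext ?_⟩
    exact one_smul R (z : M)

end Betti

/-! ### Base change of finite free modules along a ring endomorphism. -/

section ExtendScalars

variable {R : Type u} [CommRing R] (f : R →+* R)

/-- A restricted module shares its carrier with `X`; the `show` ascriptions select the original
scalar action. -/
theorem restrictScalars_hom_smul {M X : ModuleCat.{u} R}
    (g : M ⟶ (ModuleCat.restrictScalars f).obj X) (r : R) (m : M) :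
    (show X from g.hom (r • m)) = f r • (show X from g.hom m) :=
  map_smul g.hom r m

theorem restrictScalars_hom_sum {M X : ModuleCat.{u} R}
    (g : M ⟶ (ModuleCat.restrictScalars f).obj X) {ι : Type*} (s : Finset ι) (m : ι → M) :
    (show X from g.hom (∑ i ∈ s, m i)) = ∑ i ∈ s, (show X from g.hom (m i)) :=
  map_sum g.hom m s

theorem restrictScalars_comp_apply {M X Y : ModuleCat.{u} R}
    (g : M ⟶ (ModuleCat.restrictScalars f).obj X) (α : X ⟶ Y) (m : M) :
    (show Y from (g ≫ (ModuleCat.restrictScalars f).map α).hom m) =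
      α.hom (show X from g.hom m) :=
  rfl

theorem restrictScalars_precomp_apply {L M X : ModuleCat.{u} R} (h : L ⟶ M)
    (g : M ⟶ (ModuleCat.restrictScalars f).obj X) (l : L) :
    (show X from (h ≫ g).hom l) = (show X from g.hom (h.hom l)) :=
  rfl

theorem restrictScalars_postcomp_ext {M X Y : ModuleCat.{u} R}
    (g : M ⟶ (ModuleCat.restrictScalars f).obj X) {α β : X ⟶ Y}
    (h : ∀ m, α.hom (show X from g.hom m) = β.hom (show X from g.hom m)) :
    g ≫ (ModuleCat.restrictScalars f).map α = g ≫ (ModuleCat.restrictScalars f).map β :=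
  ModuleCat.hom_ext (LinearMap.ext h)

/-- The unit of the adjunction between extension and restriction of scalars. -/
def extendScalarsUnitHom (M : ModuleCat.{u} R) :
    M ⟶ (ModuleCat.restrictScalars f).obj ((ModuleCat.extendScalars.{u, u, u} f).obj M) :=
  (ModuleCat.extendRestrictScalarsAdj.{u, u, u} f).unit.app M

theorem extendScalarsUnitHom_naturality {M M' : ModuleCat.{u} R} (g : M ⟶ M') :
    g ≫ extendScalarsUnitHom f M' = extendScalarsUnitHom f M ≫
      (ModuleCat.restrictScalars f).map ((ModuleCat.extendScalars.{u, u, u} f).map g) :=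
  (ModuleCat.extendRestrictScalarsAdj.{u, u, u} f).unit.naturality g

theorem extendScalars_homEquiv_apply {M N : ModuleCat.{u} R}
    (α : (ModuleCat.extendScalars.{u, u, u} f).obj M ⟶ N) :
    (ModuleCat.extendRestrictScalarsAdj.{u, u, u} f).homEquiv M N α =
      extendScalarsUnitHom f M ≫ (ModuleCat.restrictScalars f).map α :=
  Adjunction.homEquiv_unit _ _ _ _

/-- The canonical map `M → f^* M`, `m ↦ 1 ⊗ m`. -/
def extendScalarsUnit (M : ModuleCat.{u} R) (m : M) :
    (ModuleCat.extendScalars.{u, u, u} f).obj M :=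
  (extendScalarsUnitHom f M).hom m

theorem extendScalarsUnit_smul {M : ModuleCat.{u} R} (r : R) (m : M) :
    extendScalarsUnit f M (r • m) = f r • extendScalarsUnit f M m :=
  restrictScalars_hom_smul f (extendScalarsUnitHom f M) r m

theorem extendScalarsUnit_sum {M : ModuleCat.{u} R} {ι : Type*} (s : Finset ι) (m : ι → M) :
    extendScalarsUnit f M (∑ i ∈ s, m i) = ∑ i ∈ s, extendScalarsUnit f M (m i) :=
  restrictScalars_hom_sum f (extendScalarsUnitHom f M) s m

theorem extendScalars_map_unit {M M' : ModuleCat.{u} R} (g : M ⟶ M') (m : M) :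
    ((ModuleCat.extendScalars.{u, u, u} f).map g).hom (extendScalarsUnit f M m) =
      extendScalarsUnit f M' (g.hom m) := by
  have h := extendScalarsUnitHom_naturality f g
  refine (restrictScalars_comp_apply f (extendScalarsUnitHom f M) _ m).symm.trans ?_
  rw [← h]
  exact restrictScalars_precomp_apply f g (extendScalarsUnitHom f M') m

theorem extendScalars_hom_ext {M N : ModuleCat.{u} R}
    {α β : (ModuleCat.extendScalars.{u, u, u} f).obj M ⟶ N}
    (h : ∀ m, α.hom (extendScalarsUnit f M m) = β.hom (extendScalarsUnit f M m)) : α = β := by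
  refine ((ModuleCat.extendRestrictScalarsAdj.{u, u, u} f).homEquiv M N).injective ?_
  rw [extendScalars_homEquiv_apply, extendScalars_homEquiv_apply]
  exact restrictScalars_postcomp_ext f (extendScalarsUnitHom f M) h

/-- The map `v ↦ f ∘ v`, linear over `f`. -/
def piMapRestrictScalars (m : ℕ) : ModuleCat.of R (Fin m → R) ⟶
    (ModuleCat.restrictScalars f).obj (ModuleCat.of R (Fin m → R)) :=
  ModuleCat.ofHom (Y := (ModuleCat.restrictScalars f).obj (ModuleCat.of R (Fin m → R)))
    { toFun := fun v i => f (v i)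
      map_add' := fun v w => funext fun i => map_add f (v i) (w i)
      map_smul' := fun r v => funext fun i => map_mul f r (v i) }

/-- The comparison map `f^* R^m → R^m`. -/
def extendScalarsPiHom (m : ℕ) :
    (ModuleCat.extendScalars.{u, u, u} f).obj (ModuleCat.of R (Fin m → R)) ⟶
      ModuleCat.of R (Fin m → R) :=
  ((ModuleCat.extendRestrictScalarsAdj.{u, u, u} f).homEquiv _ _).symm (piMapRestrictScalars f m)

theorem extendScalarsPiHom_unit {m : ℕ} (v : Fin m → R) :
    (extendScalarsPiHom f m).hom (extendScalarsUnit f (ModuleCat.of R (Fin m → R)) v) =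
      fun i => f (v i) := by
  have h := ((ModuleCat.extendRestrictScalarsAdj.{u, u, u} f).homEquiv
    (ModuleCat.of R (Fin m → R)) (ModuleCat.of R (Fin m → R))).apply_symm_apply
      (piMapRestrictScalars f m)
  rw [extendScalars_homEquiv_apply] at h
  exact (restrictScalars_comp_apply f (extendScalarsUnitHom f _) (extendScalarsPiHom f m) v).symm.trans
    (LinearMap.congr_fun (congrArg ModuleCat.Hom.hom h) v)

/-- The morphism from a finite free module given by a family of elements. -/
def piHomOfFamily {m : ℕ} (X : ModuleCat.{u} R) (e : Fin m → X) :
    ModuleCat.of R (Fin m → R) ⟶ X :=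
  ModuleCat.ofHom (Fintype.linearCombination R e)

theorem piHomOfFamily_apply {m : ℕ} (X : ModuleCat.{u} R) (e : Fin m → X) (v : Fin m → R) :
    (piHomOfFamily X e).hom v = ∑ i, v i • e i :=
  rfl

/-- The inverse of `extendScalarsPiHom`. -/
def extendScalarsPiInv (m : ℕ) : ModuleCat.of R (Fin m → R) ⟶
    (ModuleCat.extendScalars.{u, u, u} f).obj (ModuleCat.of R (Fin m → R)) :=
  piHomOfFamily _ fun i => extendScalarsUnit f (ModuleCat.of R (Fin m → R)) (Pi.single i 1)

theorem extendScalarsPiInv_apply {m : ℕ} (v : Fin m → R) : (extendScalarsPiInv f m).hom v =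
    ∑ i, v i • extendScalarsUnit f (ModuleCat.of R (Fin m → R)) (Pi.single i 1) :=
  piHomOfFamily_apply _ _ v

/-- Extension of scalars of a finite free module. -/
def extendScalarsPiIso (m : ℕ) :
    (ModuleCat.extendScalars.{u, u, u} f).obj (ModuleCat.of R (Fin m → R)) ≅
      ModuleCat.of R (Fin m → R) where
  hom := extendScalarsPiHom f m
  inv := extendScalarsPiInv f m
  hom_inv_id := by
    refine extendScalars_hom_ext f fun v => ?_
    change (extendScalarsPiInv f m).hom ((extendScalarsPiHom f m).hom
      (extendScalarsUnit f (ModuleCat.of R (Fin m → R)) v)) =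
        extendScalarsUnit f (ModuleCat.of R (Fin m → R)) v
    rw [extendScalarsPiHom_unit, extendScalarsPiInv_apply]
    have hv : v = ∑ i, v i • (Pi.single i 1 : Fin m → R) := by
      conv_lhs => rw [← (Pi.basisFun R (Fin m)).sum_repr v]
      simp
    conv_rhs => rw [hv]
    refine Eq.trans ?_ (extendScalarsUnit_sum f (M := ModuleCat.of R (Fin m → R)) _ _).symm
    exact Finset.sum_congr rfl fun i _ =>
      (extendScalarsUnit_smul f (M := ModuleCat.of R (Fin m → R)) (v i) (Pi.single i 1)).symm
  inv_hom_id := by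
    refine ModuleCat.hom_ext (LinearMap.pi_ext' fun i => LinearMap.ext_ring ?_)
    change (extendScalarsPiHom f m).hom ((extendScalarsPiInv f m).hom (Pi.single i 1)) =
      (Pi.single i 1 : Fin m → R)
    have : (extendScalarsPiInv f m).hom (Pi.single i 1) =
        extendScalarsUnit f (ModuleCat.of R (Fin m → R)) (Pi.single i 1) := by
      rw [extendScalarsPiInv_apply, Finset.sum_eq_single i]
      · rw [Pi.single_eq_same, one_smul]
      · intro j _ hj
        rw [Pi.single_eq_of_ne hj, zero_smul]
      · simp
    rw [this, extendScalarsPiHom_unit]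
    funext j
    by_cases hj : j = i
    · subst hj; simp
    · simp [hj]

/-- Identifies base change of a matrix with its entrywise twist. It suffices to compare on the
elements `1 ⊗ v`, where both composites give `f` applied to the coordinates of `φ v`. -/
theorem extendScalarsPiIso_naturality {m n : ℕ} (φ : (Fin m → R) →ₗ[R] (Fin n → R)) :
    (extendScalarsPiIso f m).hom ≫ ModuleCat.ofHom (twistMap f φ) =
      (ModuleCat.extendScalars.{u, u, u} f).map (ModuleCat.ofHom φ) ≫
        (extendScalarsPiIso f n).hom := by
  refine extendScalars_hom_ext f fun v => ?_
  change twistMap f φ ((extendScalarsPiHom f m).hom _) = (extendScalarsPiHom f n).hom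
    (((ModuleCat.extendScalars.{u, u, u} f).map (ModuleCat.ofHom φ)).hom _)
  rw [extendScalars_map_unit, extendScalarsPiHom_unit]
  exact (twistMap_comp_apply f φ v).trans (extendScalarsPiHom_unit f (φ v)).symm

end ExtendScalars

/-! ### Free resolutions as projective resolutions. -/

section FreeResolutionComplex

variable {R : Type u} [CommRing R] {M : Type u} [AddCommGroup M] [Module R M] {b : ℕ → ℕ}
  {d : ∀ i, (Fin (b (i + 1)) → R) →ₗ[R] (Fin (b i) → R)} {ε : (Fin (b 0) → R) →ₗ[R] M}

/-- The chain complex of a free resolution. -/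
def IsFreeResolution.complex (h : IsFreeResolution R M b d ε) : ChainComplex (ModuleCat.{u} R) ℕ :=
  ChainComplex.of (fun i => ModuleCat.of R (Fin (b i) → R)) (fun i => ModuleCat.ofHom (d i))
    fun i => by rw [← ModuleCat.ofHom_comp, (h.exact_succ i).linearMap_comp_eq_zero]; rfl

theorem IsFreeResolution.complex_d (h : IsFreeResolution R M b d ε) (i : ℕ) :
    h.complex.d (i + 1) i = ModuleCat.ofHom (d i) :=
  ChainComplex.of_d (fun i => ModuleCat.of R (Fin (b i) → R)) (fun i => ModuleCat.ofHom (d i)) i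

theorem IsFreeResolution.complex_exactAt_succ (h : IsFreeResolution R M b d ε) (i : ℕ) :
    h.complex.ExactAt (i + 1) := by
  rw [HomologicalComplex.exactAt_iff' _ (i + 2) (i + 1) i (by simp) (by simp),
    ShortComplex.ShortExact.moduleCat_exact_iff_function_exact]
  change Function.Exact (h.complex.d (i + 1 + 1) (i + 1)).hom (h.complex.d (i + 1) i).hom
  rw [h.complex_d, h.complex_d]
  exact h.exact_succ i

/-- The augmentation of the chain complex of a free resolution. -/
def IsFreeResolution.augmentation (h : IsFreeResolution R M b d ε) :
    h.complex ⟶ (ChainComplex.single₀ (ModuleCat.{u} R)).obj (ModuleCat.of R M) :=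
  (ChainComplex.toSingle₀Equiv _ _).symm ⟨ModuleCat.ofHom ε, by
    rw [h.complex_d]
    exact ModuleCat.hom_ext h.exact_zero.linearMap_comp_eq_zero⟩

theorem IsFreeResolution.augmentation_f_zero (h : IsFreeResolution R M b d ε) :
    h.augmentation.f 0 = ModuleCat.ofHom ε :=
  ChainComplex.toSingle₀Equiv_symm_apply_f_zero _ _

/-- A free resolution as a projective resolution. -/
def IsFreeResolution.projectiveResolution (h : IsFreeResolution R M b d ε) :
    ProjectiveResolution (ModuleCat.of R M) where
  complex := h.complex
  projective i := ModuleCat.projective_of_free (Pi.basisFun R (Fin (b i)))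
  π := h.augmentation
  quasiIso := ⟨fun n => by
    cases n
    · rw [ChainComplex.quasiIsoAt₀_iff, ShortComplex.quasiIso_iff_of_zeros']
      · refine (ShortComplex.exact_and_epi_g_iff_of_iso (S₂ := exactShortComplex h.exact_zero)
          ?_).2 ⟨(ShortComplex.ShortExact.moduleCat_exact_iff_function_exact _).mpr h.exact_zero,
            (ModuleCat.epi_iff_surjective _).mpr h.surjective⟩
        refine ShortComplex.isoMk (Iso.refl _) (Iso.refl _) (Iso.refl _)
          ((Category.id_comp _).trans ((h.complex_d 0).symm.trans (Category.comp_id _).symm)) ?_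
        exact (Category.id_comp _).trans (h.augmentation_f_zero.symm.trans
          (Category.comp_id _).symm)
      all_goals rfl
    · rw [quasiIsoAt_iff_exactAt']
      · apply h.complex_exactAt_succ
      · apply ChainComplex.exactAt_succ_single_obj⟩

end FreeResolutionComplex

/-! ### Frobenius Tor as relations modulo twisted relations. -/

section FrobTor

variable {R : Type u} [CommRing R]

/-- A composable pair of linear maps with zero composite, as a short complex. -/
def shortComplexOfComp {A B C : Type u} [AddCommGroup A] [Module R A] [AddCommGroup B] [Module R B]
    [AddCommGroup C] [Module R C] (φ : A →ₗ[R] B) (ψ : B →ₗ[R] C) (h : ψ ∘ₗ φ = 0) :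
    ShortComplex (ModuleCat.{u} R) :=
  ShortComplex.mk (ModuleCat.ofHom φ) (ModuleCat.ofHom ψ) (ModuleCat.hom_ext h)

/-- The homology of a short complex of modules is the quotient of the kernel by the image. -/
theorem exists_surjective_homology (S : ShortComplex (ModuleCat.{u} R)) :
    ∃ π : LinearMap.ker S.g.hom →ₗ[R] S.homology,
      Function.Surjective π ∧ ∀ z, π z = 0 ↔ ∃ w, S.f.hom w = z := by
  let e := S.moduleCatHomologyIso.toLinearEquiv.symm
  refine ⟨e.toLinearMap ∘ₗ (LinearMap.range S.moduleCatToCycles).mkQ,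
    e.surjective.comp (Submodule.mkQ_surjective _), fun z => ?_⟩
  refine (e.map_eq_zero_iff).trans ((Submodule.Quotient.mk_eq_zero _).trans ?_)
  exact exists_congr fun w => Subtype.ext_iff

theorem twistMap_id {m n : ℕ} (φ : (Fin m → R) →ₗ[R] (Fin n → R)) :
    twistMap (RingHom.id R) φ = φ := by
  refine (congrArg Matrix.toLin' ?_).trans (Matrix.toLin'_toMatrix' φ)
  exact Matrix.ext fun i j => rfl

variable (p : ℕ) [ExpChar R p] {M : Type u} [AddCommGroup M] [Module R M] {b : ℕ → ℕ}
  {d : ∀ i, (Fin (b (i + 1)) → R) →ₗ[R] (Fin (b i) → R)} {ε : (Fin (b 0) → R) →ₗ[R] M}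

/-- `Tor_1^R(M, ^{f^n}R)` from a free resolution of `M`. -/
theorem IsFreeResolution.exists_surjective_frobTor_one (h : IsFreeResolution R M b d ε) (n : ℕ) :
    ∃ π : LinearMap.ker (twistMap (iterateFrobenius R p n) (d 0)) →ₗ[R] frobTor R p n 1 M,
      Function.Surjective π ∧
        ∀ z, π z = 0 ↔ ∃ w, twistMap (iterateFrobenius R p n) (d 1) w = z := by
  let f := iterateFrobenius R p n
  have h0 : twistMap f (d 0) ∘ₗ twistMap f (d 1) = 0 := by
    rw [← twistMap_comp, (h.exact_succ 0).linearMap_comp_eq_zero, twistMap_zero]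
  obtain ⟨π, hπ, hπ0⟩ := exists_surjective_homology (shortComplexOfComp _ _ h0)
  let K := ((frobFunctor R p n).mapHomologicalComplex (ComplexShape.down ℕ)).obj h.complex
  let e : K.sc' 2 1 0 ≅ shortComplexOfComp _ _ h0 :=
    ShortComplex.isoMk (extendScalarsPiIso f (b 2)) (extendScalarsPiIso f (b 1))
      (extendScalarsPiIso f (b 0))
      ((extendScalarsPiIso_naturality f (d 1)).trans
        (congrArg (fun g => (frobFunctor R p n).map g ≫ (extendScalarsPiIso f (b 1)).hom)
          (h.complex_d 1).symm))
      ((extendScalarsPiIso_naturality f (d 0)).trans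
        (congrArg (fun g => (frobFunctor R p n).map g ≫ (extendScalarsPiIso f (b 0)).hom)
          (h.complex_d 0).symm))
  let e' : (shortComplexOfComp _ _ h0).homology ≅ frobTor R p n 1 M :=
    (ShortComplex.homologyMapIso e).symm ≪≫
      (K.homologyIsoSc' 2 1 0 (by simp) (by simp)).symm ≪≫
      (h.projectiveResolution.isoLeftDerivedObj (frobFunctor R p n) 1).symm
  exact ⟨e'.toLinearEquiv.toLinearMap ∘ₗ π, e'.toLinearEquiv.surjective.comp hπ,
    fun z => (e'.toLinearEquiv.map_eq_zero_iff).trans (hπ0 z)⟩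

variable [IsLocalRing R] [IsNoetherianRing R]

/-- `Tor_1^R(R/I, ^{f^n}R)` in terms of the relations of the `q`-th powers of generators of `I`. -/
theorem exists_surjective_frobTor_one_quotient {k : ℕ} (G : Fin k → R) :
    ∃ (l : ℕ) (B : (Fin l → R) →ₗ[R] (Fin k → R)),
      (∀ v : Fin k → R, ∑ j, G j * v j = 0 → v ∈ LinearMap.range B) ∧
      ∀ n, ∃ (π : LinearMap.ker (Fintype.linearCombination R fun j => G j ^ p ^ n) →ₗ[R]
          frobTor R p n 1 (R ⧸ Ideal.span (Set.range G)))
        (ψ : (Fin l → R) →ₗ[R] LinearMap.ker (Fintype.linearCombination R fun j => G j ^ p ^ n)),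
        Function.Surjective π ∧ Function.Exact ψ π ∧
          ∀ w, (ψ w : Fin k → R) = twistMap (iterateFrobenius R p n) B w := by
  let φ₀ : (Fin 1 → R) →ₗ[R] R ⧸ Ideal.span (Set.range G) :=
    (Ideal.span (Set.range G)).mkQ ∘ₗ LinearMap.proj 0
  have hφ₀ : Function.Surjective φ₀ := fun z => by
    obtain ⟨r, rfl⟩ := Submodule.Quotient.mk_surjective _ z
    exact ⟨fun _ => r, rfl⟩
  have hker : ∀ v, v ∈ LinearMap.ker φ₀ ↔ v 0 ∈ Ideal.span (Set.range G) := fun v =>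
    Submodule.Quotient.mk_eq_zero _
  let φ₁ : (Fin k → R) →ₗ[R] LinearMap.ker φ₀ :=
    (LinearMap.pi fun _ => Fintype.linearCombination R G).codRestrict _ fun v =>
      (hker _).mpr (show ∑ j, v j * G j ∈ Ideal.span (Set.range G) from Ideal.sum_mem _ fun j _ =>
        Ideal.mul_mem_left _ (v j) (Ideal.subset_span (Set.mem_range_self j)))
  have hφ₁ : Function.Surjective φ₁ := by
    rintro ⟨w, hw⟩
    obtain ⟨c, hc⟩ := Ideal.mem_span_range_iff_exists_fun.mp ((hker w).mp hw)
    refine ⟨c, Subtype.ext (funext fun i => ?_)⟩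
    obtain rfl := Subsingleton.elim i 0
    exact hc
  -- The first two terms are fixed by the given generators, which need not be minimal; only the tail
  -- is chosen minimal. Nothing here depends on `n`.
  obtain ⟨b, d, ε, h⟩ := exists_isMinimalFreeResolution (R := R) (LinearMap.ker φ₁)
  have hres := (h.isFreeResolution.cons hφ₁).cons hφ₀
  refine ⟨b 0, (LinearMap.ker φ₁).subtype ∘ₗ ε, fun v hv => ?_, fun n => ?_⟩
  · have hv' : φ₁ v = 0 := Subtype.ext (funext fun i =>
      (Finset.sum_congr rfl fun j _ => mul_comm (v j) (G j)).trans hv)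
    obtain ⟨w, hw⟩ := h.surjective ⟨v, hv'⟩
    exact ⟨w, congrArg Subtype.val hw⟩
  · obtain ⟨π, hπ, hπ0⟩ := hres.exists_surjective_frobTor_one p n
    let d₀ : (Fin k → R) →ₗ[R] (Fin 1 → R) := (LinearMap.ker φ₀).subtype ∘ₗ φ₁
    have hd₀ : ∀ j i, d₀ (Pi.single j 1) i = G j := fun j i => by
      change Fintype.linearCombination R G (Pi.single j 1) = G j
      simp
    have heq : LinearMap.ker (Fintype.linearCombination R fun j => G j ^ p ^ n) =
        LinearMap.ker (twistMap (iterateFrobenius R p n) d₀) := by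
      ext v
      have hv : ∀ i, twistMap (iterateFrobenius R p n) d₀ v i =
          Fintype.linearCombination R (fun j => G j ^ p ^ n) v := fun i => by
        rw [twistMap_apply, Fintype.linearCombination_apply]
        refine Finset.sum_congr rfl fun j _ => ?_
        rw [hd₀, iterateFrobenius_def, smul_eq_mul, mul_comm]
      rw [LinearMap.mem_ker, LinearMap.mem_ker, funext_iff]
      simp [hv]
    have hcomp : twistMap (iterateFrobenius R p n) d₀ ∘ₗ
        twistMap (iterateFrobenius R p n) ((LinearMap.ker φ₁).subtype ∘ₗ ε) = 0 := by
      rw [← twistMap_comp]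
      exact (congrArg _ (hres.exact_succ 0).linearMap_comp_eq_zero).trans (twistMap_zero _)
    refine ⟨π ∘ₗ (LinearEquiv.ofEq _ _ heq).toLinearMap,
      (twistMap (iterateFrobenius R p n) ((LinearMap.ker φ₁).subtype ∘ₗ ε)).codRestrict _ fun w =>
        heq ▸ LinearMap.congr_fun hcomp w,
      hπ.comp (LinearEquiv.ofEq _ _ heq).surjective, fun z => (hπ0 _).trans ?_, fun w => rfl⟩
    exact exists_congr fun w => ⟨fun hw => Subtype.ext hw, fun hw => congrArg Subtype.val hw⟩

end FrobTor

/-! ### Factoring a linear map through a surjection. -/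

section Factor

variable {R : Type u} [CommRing R] {Z K T : Type u} [AddCommGroup Z] [Module R Z] [AddCommGroup K]
  [Module R K] [AddCommGroup T] [Module R T]

theorem exists_comp_eq_of_ker_le {ρ : Z →ₗ[R] K} (hρ : Function.Surjective ρ) {π : Z →ₗ[R] T}
    (h : LinearMap.ker ρ ≤ LinearMap.ker π) : ∃ θ : K →ₗ[R] T, ∀ z, θ (ρ z) = π z := by
  refine ⟨(LinearMap.ker ρ).liftQ π h ∘ₗ (ρ.quotKerEquivOfSurjective hρ).symm.toLinearMap,
    fun z => ?_⟩
  have : (ρ.quotKerEquivOfSurjective hρ).symm (ρ z) = Submodule.Quotient.mk z :=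
    (LinearEquiv.symm_apply_eq _).mpr rfl
  rw [LinearMap.comp_apply, LinearEquiv.coe_coe, this]
  rfl

end Factor

/-! ### Comparison of Frobenius Tor with the colon ideal. -/

section ColonComparison

variable {R : Type u} [CommRing R] [IsLocalRing R] [IsNoetherianRing R] (p : ℕ) [ExpChar R p]

/-- Up to a bounded length, `Tor_1^R(R/(J + xR), ^{f^n}R)` is `(J^[q] : x^q)`. -/
theorem exists_frobTor_colon_bounds {m l : ℕ} (g : Fin m → R)
    (A : (Fin l → R) →ₗ[R] (Fin m → R))
    (hA : ∀ n (v : Fin m → R), ∑ j, g j ^ p ^ n * v j = 0 ↔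
      v ∈ LinearMap.range (twistMap (iterateFrobenius R p n) A)) (x : R)
    (N : Type u) [AddCommGroup N] [Module R N] :
    ∃ c : ℕ, ∀ n,
      Module.length R (frobTor R p n 1 (R ⧸ Ideal.span (Set.range g) ⊔ Ideal.span {x}) ⊗[R] N) ≤
        Module.length R (Submodule.comap (LinearMap.mulRight R (x ^ p ^ n))
          (frobPower p (Ideal.span (Set.range g)) n) ⊗[R] N) ∧
      Module.length R (Submodule.comap (LinearMap.mulRight R (x ^ p ^ n))
          (frobPower p (Ideal.span (Set.range g)) n) ⊗[R] N) ≤ c * Module.length R N +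
        Module.length R
          (frobTor R p n 1 (R ⧸ Ideal.span (Set.range g) ⊔ Ideal.span {x}) ⊗[R] N) := by
  have hI : Ideal.span (Set.range g) ⊔ Ideal.span {x} =
      Ideal.span (Set.range (Fin.cons x g : Fin (m + 1) → R)) := by
    rw [Fin.range_cons, Ideal.span_insert, sup_comm]
  rw [hI]
  obtain ⟨c, B, hB, hπ⟩ := exists_surjective_frobTor_one_quotient p (Fin.cons x g : Fin (m + 1) → R)
  let ι : (Fin m → R) →ₗ[R] (Fin (m + 1) → R) :=
    LinearMap.pi (Fin.cons (0 : (Fin m → R) →ₗ[R] R) fun i => LinearMap.proj i)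
  have hι0 : ∀ v, ι v 0 = 0 := fun v => rfl
  have hιs : ∀ v i, ι v (Fin.succ i) = v i := fun v i => rfl
  have hιt : ∀ f : R →+* R, twistMap f ι = ι := fun f => by
    refine LinearMap.ext fun v => funext fun i => ?_
    rw [twistMap_apply]
    refine Fin.cases ?_ (fun i => ?_) i
    · simp [hι0]
    · simp [hιs, Pi.single_apply]
  -- Relations of `g`, padded by a zero `x`-coordinate, are relations of `x, g`. The case `n = 0` of
  -- `hA`, with trivial twist, shows that the columns of `A` are such relations.
  obtain ⟨C, hC⟩ := exists_comp_eq_of_range_le B (ι ∘ₗ A) (by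
    rintro _ ⟨w, rfl⟩
    refine hB _ ?_
    rw [Fin.sum_univ_succ]
    simp only [LinearMap.comp_apply, hι0, hιs, Fin.cons_succ, mul_zero, zero_add]
    simpa [iterateFrobenius_zero, twistMap_id] using hA 0 (A w))
  refine ⟨c, fun n => ?_⟩
  obtain ⟨π, ψ, hπs, hψπ, hψ⟩ := hπ n
  let G : Fin (m + 1) → R := Fin.cons x g
  have hsum : ∀ v : Fin (m + 1) → R, Fintype.linearCombination R (fun j => G j ^ p ^ n) v =
      v 0 * x ^ p ^ n + ∑ j, v (Fin.succ j) * g j ^ p ^ n := fun v => by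
    rw [Fintype.linearCombination_apply, Fin.sum_univ_succ]
    rfl
  have hJ : frobPower p (Ideal.span (Set.range g)) n =
      Ideal.span (Set.range fun j => g j ^ p ^ n) := by
    rw [frobPower_span, ← Set.range_comp]
    rfl
  -- The `x`-coordinate of a relation between `x^q` and the `g_j^q` lies in the colon ideal, and
  -- every element of that ideal occurs.
  let ρ : LinearMap.ker (Fintype.linearCombination R fun j => G j ^ p ^ n) →ₗ[R]
      Submodule.comap (LinearMap.mulRight R (x ^ p ^ n))
        (frobPower p (Ideal.span (Set.range g)) n) :=
    ((LinearMap.proj 0) ∘ₗ (LinearMap.ker _).subtype).codRestrict _ fun z => by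
      have hz := (hsum z).symm.trans z.2
      change (z : Fin (m + 1) → R) 0 * x ^ p ^ n ∈ frobPower p (Ideal.span (Set.range g)) n
      rw [eq_neg_of_add_eq_zero_left hz, hJ]
      exact Submodule.neg_mem _ (Ideal.sum_mem _ fun j _ =>
        Ideal.mul_mem_left _ _ (Ideal.subset_span (Set.mem_range_self j)))
  have hρ : Function.Surjective ρ := by
    rintro ⟨s, hs⟩
    have hs' : s * x ^ p ^ n ∈ Ideal.span (Set.range fun j => g j ^ p ^ n) := hJ ▸ hs
    obtain ⟨e, he⟩ := Ideal.mem_span_range_iff_exists_fun.mp hs'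
    refine ⟨⟨Fin.cons s fun j => - e j, ?_⟩, rfl⟩
    rw [LinearMap.mem_ker, hsum]
    simp [← he]
  -- With zero `x`-coordinate one has a relation of the `g_j^q`, hence a twist of `A`. Since `ι A =
  -- B C` and `ι` is its own twist, it is a twisted relation of `x, g` and dies in Tor.
  have hker : LinearMap.ker ρ ≤ LinearMap.ker π := by
    intro z hz
    have hz0 : (z : Fin (m + 1) → R) 0 = 0 := congrArg Subtype.val hz
    have hz' := (hsum z).symm.trans z.2
    rw [hz0, zero_mul, zero_add] at hz'
    obtain ⟨w, hw⟩ := (hA n fun j => (z : Fin (m + 1) → R) (Fin.succ j)).mp (by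
      simpa only [mul_comm] using hz')
    refine (hψπ z).mpr ⟨twistMap (iterateFrobenius R p n) C w, Subtype.ext ?_⟩
    rw [hψ, ← LinearMap.comp_apply, ← twistMap_comp, hC, twistMap_comp, hιt, LinearMap.comp_apply, hw]
    refine funext fun i => Fin.cases ?_ (fun i => ?_) i
    · rw [hι0, hz0]
    · rw [hιs]
  obtain ⟨θ, hθ⟩ := exists_comp_eq_of_ker_le hρ hker
  have hθs : Function.Surjective θ := fun t => by
    obtain ⟨z, rfl⟩ := hπs t
    exact ⟨ρ z, hθ z⟩
  refine ⟨length_tensor_le_of_surjective N hθs, ?_⟩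
  -- The kernel of `θ` is generated by the `x`-coordinates of the `c` twisted relations, whence the
  -- constant `c`.
  have hex : Function.Exact (ρ ∘ₗ ψ) θ := by
    intro s
    constructor
    · obtain ⟨z, rfl⟩ := hρ s
      rw [hθ]
      intro hz
      obtain ⟨w, rfl⟩ := (hψπ z).mp hz
      exact ⟨w, rfl⟩
    · rintro ⟨w, rfl⟩
      exact (hθ _).trans (hψπ.apply_apply_eq_zero w)
  exact (length_tensor_le_add N hex hθs).trans (add_le_add_left (length_pi_tensor N c).le _)

end ColonComparison

/-! ### Calculus of bounded differences. -/

section BoundedDifferences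

theorem BoundedDifference.of_eventually {g h : ℕ → ℕ∞} (hg : ∀ n, g n ≠ ⊤) (hh : ∀ n, h n ≠ ⊤)
    {C : ℕ∞} (hC : C ≠ ⊤) (hgh : ∀ᶠ n in Filter.atTop, g n ≤ h n + C ∧ h n ≤ g n + C) :
    BoundedDifference g h := by
  obtain ⟨n₀, hn₀⟩ := Filter.eventually_atTop.mp hgh
  lift C to ℕ using hC
  lift g to ℕ → ℕ using hg
  lift h to ℕ → ℕ using hh
  beta_reduce at hn₀
  -- The finitely many indices below `n₀` are absorbed into the constant.
  obtain ⟨K, hK⟩ : ∃ K, K = ∑ i ∈ Finset.range n₀, (g i + h i) := ⟨_, rfl⟩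
  refine ⟨fun n => ENat.natCast_ne_top _, fun n => ENat.natCast_ne_top _, C + K, fun n => ?_⟩
  beta_reduce
  suffices g n ≤ h n + (C + K) ∧ h n ≤ g n + (C + K) by
    exact ⟨by exact_mod_cast this.1, by exact_mod_cast this.2⟩
  rcases Nat.lt_or_ge n n₀ with hn | hn
  · have : g n + h n ≤ K := hK ▸ Finset.single_le_sum (f := fun i => g i + h i)
      (fun i _ => Nat.zero_le _) (Finset.mem_range.mpr hn)
    omega
  · have h1 : g n ≤ h n + C := by exact_mod_cast (hn₀ n hn).1
    have h2 : h n ≤ g n + C := by exact_mod_cast (hn₀ n hn).2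
    omega

theorem BoundedDifference.symm {g h : ℕ → ℕ∞} (hgh : BoundedDifference g h) :
    BoundedDifference h g :=
  ⟨hgh.2.1, hgh.1, hgh.2.2.imp fun _ hC n => (hC n).symm⟩

theorem BoundedDifference.trans {f g h : ℕ → ℕ∞} (hfg : BoundedDifference f g)
    (hgh : BoundedDifference g h) : BoundedDifference f h := by
  obtain ⟨hf, -, C, hC⟩ := hfg
  obtain ⟨-, hh, D, hD⟩ := hgh
  refine ⟨hf, hh, C + D, fun n => ⟨?_, ?_⟩⟩
  · calc f n ≤ g n + C := (hC n).1
      _ ≤ h n + D + C := by gcongr; exact (hD n).1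
      _ = h n + (C + D : ℕ) := by push_cast; ring
  · calc h n ≤ g n + D := (hD n).2
      _ ≤ f n + C + D := by gcongr; exact (hC n).2
      _ = f n + (C + D : ℕ) := by push_cast; ring

end BoundedDifferences

/-! ### Assembly of the three comparisons. -/

section Main

open IsLocalRing

variable {R : Type u} [CommRing R]

/-- `(0 :_{R/𝔧} y)` is `(𝔧 : y)/𝔧`, and tensoring is right exact. -/
theorem length_torsionBy_tensor_le (N : Type u) [AddCommGroup N] [Module R N] (𝔧 : Ideal R)
    (y : R) : Module.length R (Submodule.torsionBy R (R ⧸ 𝔧) y ⊗[R] N) ≤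
        Module.length R (Submodule.comap (LinearMap.mulRight R y) 𝔧 ⊗[R] N) ∧
      Module.length R (Submodule.comap (LinearMap.mulRight R y) 𝔧 ⊗[R] N) ≤
        Module.length R (𝔧 ⊗[R] N) +
          Module.length R (Submodule.torsionBy R (R ⧸ 𝔧) y ⊗[R] N) := by
  have hle : 𝔧 ≤ Submodule.comap (LinearMap.mulRight R y) 𝔧 := fun s hs => 𝔧.mul_mem_right y hs
  let ρ : Submodule.comap (LinearMap.mulRight R y) 𝔧 →ₗ[R] Submodule.torsionBy R (R ⧸ 𝔧) y :=
    (𝔧.mkQ ∘ₗ Submodule.subtype _).codRestrict _ fun s => by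
      refine (Submodule.mem_torsionBy_iff _ _).mpr ((Submodule.Quotient.mk_eq_zero 𝔧).mpr ?_)
      have hs : (s : R) * y ∈ 𝔧 := s.2
      rwa [mul_comm] at hs
  have hρ : Function.Surjective ρ := by
    rintro ⟨z, hz⟩
    obtain ⟨s, rfl⟩ := Submodule.Quotient.mk_surjective _ z
    have hs : y * s ∈ 𝔧 := (Submodule.Quotient.mk_eq_zero 𝔧).mp hz
    rw [mul_comm] at hs
    exact ⟨⟨s, hs⟩, rfl⟩
  have hex : Function.Exact (Submodule.inclusion hle) ρ := fun s => by
    constructor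
    · intro hs
      exact ⟨⟨s, (Submodule.Quotient.mk_eq_zero 𝔧).mp (congrArg Subtype.val hs)⟩, rfl⟩
    · rintro ⟨w, rfl⟩
      exact Subtype.ext ((Submodule.Quotient.mk_eq_zero 𝔧).mpr w.2)
  exact ⟨length_tensor_le_of_surjective N hρ, length_tensor_le_add N hex hρ⟩

theorem frobPower_sup_span_singleton (p : ℕ) [ExpChar R p] (J : Ideal R) (x : R) (n : ℕ) :
    frobPower p (J ⊔ Ideal.span {x}) n = frobPower p J n ⊔ Ideal.span {x ^ p ^ n} := by
  rw [frobPower_eq_map, Ideal.map_sup, Ideal.map_span, Set.image_singleton]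
  rfl

theorem length_hom_quotient_le (a L : Ideal R) :
    Module.length R ((R ⧸ a) →ₗ[R] (R ⧸ L)) ≤ Module.length R (R ⧸ L) := by
  refine Module.length_le_of_injective (LinearMap.applyₗ (R := R) (M₂ := R ⧸ L)
    (Submodule.Quotient.mk 1 : R ⧸ a)) fun φ ψ h => ?_
  exact (LinearMap.cancel_right (Submodule.mkQ_surjective _)).mp (LinearMap.ext_ring h)

variable [IsLocalRing R]

theorem radical_eq_maximalIdeal {L : Ideal R} [Nontrivial (R ⧸ L)] [IsArtinianRing (R ⧸ L)] :
    L.radical = maximalIdeal R := by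
  have : IsLocalRing (R ⧸ L) := IsLocalRing.of_surjective' _ Ideal.Quotient.mk_surjective
  have : IsLocalHom (Ideal.Quotient.mk L) := .of_surjective _ Ideal.Quotient.mk_surjective
  ext r
  have h : r ∈ L.radical ↔ IsNilpotent (Ideal.Quotient.mk L r) :=
    exists_congr fun k => by rw [← map_pow, Ideal.Quotient.eq_zero_iff_mem]
  rw [h, Ring.KrullDimLE.isNilpotent_iff_mem_maximalIdeal]
  exact ⟨fun h => by_contra fun h' => h (((notMem_maximalIdeal).mp h').map _),
    fun h h' => h (isUnit_of_map_unit _ _ h')⟩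

variable [IsNoetherianRing R]

theorem length_quotient_ne_top {L : Ideal R} (hL : L.radical = maximalIdeal R) :
    Module.length R (R ⧸ L) ≠ ⊤ := by
  have hne : L ≠ ⊤ := fun h => Ideal.IsPrime.ne_top' (I := maximalIdeal R)
    (by rw [← hL, h, Ideal.radical_top])
  have : Nontrivial (R ⧸ L) := Ideal.Quotient.nontrivial_iff.mpr hne
  have : IsLocalRing (R ⧸ L) := IsLocalRing.of_surjective' _ Ideal.Quotient.mk_surjective
  have : IsArtinianRing (R ⧸ L) := by
    rw [isArtinianRing_iff_isNilpotent_maximalIdeal]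
    obtain ⟨k, hk⟩ := Ideal.exists_pow_le_of_le_radical_of_fg hL.ge (IsNoetherian.noetherian _)
    refine ⟨k, ?_⟩
    rw [← IsLocalRing.map_maximalIdeal_of_surjective _ Ideal.Quotient.mk_surjective, ← Ideal.map_pow]
    exact (Ideal.map_eq_bot_iff_le_ker _).mpr (hk.trans Ideal.mk_ker.ge)
  have : IsArtinian R (R ⧸ L) :=
    isArtinian_of_surjective_algebraMap (M := R ⧸ L) (R := R ⧸ L) (S := R)
      Ideal.Quotient.mk_surjective
  exact Module.length_ne_top

/-- The three length functions, for an arbitrary ideal `a` of finite colength. -/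
theorem boundedDifference_hom_frobTor_torModule (p : ℕ) [Fact p.Prime] [CharP R p]
    (J a : Ideal R) (x : R) (hI : (J ⊔ Ideal.span {x}).radical = maximalIdeal R)
    (ha : a.radical = maximalIdeal R)
    (hJpd : projectiveDimension (ModuleCat.of R J) ≠ ⊤)
    (hJGor : ∀ᶠ n in Filter.atTop,
      IsArtinianRing (R ⧸ frobPower p J n) ∧ IsGorensteinLocal (R ⧸ frobPower p J n)) :
    BoundedDifference
      (fun n => Module.length R ((R ⧸ a) →ₗ[R] (R ⧸ frobPower p (J ⊔ Ideal.span {x}) n)))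
      (fun n => Module.length R
        (frobTor R p n 1 (R ⧸ J ⊔ Ideal.span {x}) ⊗[R] (R ⧸ a))) ∧
    BoundedDifference
      (fun n => Module.length R
        (frobTor R p n 1 (R ⧸ J ⊔ Ideal.span {x}) ⊗[R] (R ⧸ a)))
      (fun n => Module.length R
        (torModule R 2 (R ⧸ frobPower p (J ⊔ Ideal.span {x}) n) (R ⧸ a))) := by
  -- A single `q` with `R/J^[q]` Artinian local shows that `J` is primary to the maximal ideal, as
  -- `J^[q]` and `J` have the same radical.
  have hJ : J.radical = maximalIdeal R := by
    obtain ⟨n, hn, hn'⟩ := hJGor.exists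
    have := hn'.1
    rw [← radical_frobPower p J n]
    exact radical_eq_maximalIdeal
  obtain ⟨m, l, g, A, rfl, hA⟩ := exists_presentation_of_projectiveDimension_ne_top p J hJ hJpd
  obtain ⟨c, hc⟩ := exists_frobTor_colon_bounds p g A hA x (R ⧸ a)
  set J := Ideal.span (Set.range g) with hJg
  have hN := length_quotient_ne_top ha
  -- The common term of comparison.
  let κ : ℕ → ℕ∞ := fun n => Module.length R
    (Submodule.comap (LinearMap.mulRight R (x ^ p ^ n)) (frobPower p J n) ⊗[R] (R ⧸ a))
  have hκ : ∀ n, κ n ≠ ⊤ := fun n => length_tensor_ne_top _ hN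
  have hJn : ∀ n, frobPower p J n = Ideal.span (Set.range fun j => g j ^ p ^ n) := fun n => by
    rw [frobPower_span, ← Set.range_comp]
    rfl
  have hφ : ∀ n, ∃ φ : (Fin m → R) →ₗ[R] frobPower p J n, Function.Surjective φ ∧
      Function.Exact (twistMap (iterateFrobenius R p n) A) φ := fun n => by
    let φ : (Fin m → R) →ₗ[R] frobPower p J n :=
      (Fintype.linearCombination R fun j => g j ^ p ^ n).codRestrict _ fun v => hJn n ▸
        (show ∑ j, v j * g j ^ p ^ n ∈ Ideal.span (Set.range fun j => g j ^ p ^ n) from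
          Ideal.sum_mem _ fun j _ =>
            Ideal.mul_mem_left _ (v j) (Ideal.subset_span (Set.mem_range_self j)))
    refine ⟨φ, ?_, fun v => ?_⟩
    · rintro ⟨s, hs⟩
      rw [hJn n] at hs
      obtain ⟨e, he⟩ := Ideal.mem_span_range_iff_exists_fun.mp hs
      exact ⟨e, Subtype.ext he⟩
    · refine Iff.trans ?_ (hA n v)
      have : (φ v : R) = ∑ j, g j ^ p ^ n * v j :=
        show ∑ j, v j * g j ^ p ^ n = _ from
          Finset.sum_congr rfl fun j _ => mul_comm (v j) (g j ^ p ^ n)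
      rw [← this, ZeroMemClass.coe_eq_zero]
  have hmul : ∀ k : ℕ, k * Module.length R (R ⧸ a) ≠ ⊤ := fun k =>
    WithTop.mul_ne_top (ENat.natCast_ne_top k) hN
  have hadd : ∀ {s t : ℕ∞}, s ≠ ⊤ → t ≠ ⊤ → s + t ≠ ⊤ := fun hs ht =>
    WithTop.add_ne_top.mpr ⟨hs, ht⟩
  have hJN : ∀ n, Module.length R (frobPower p J n ⊗[R] (R ⧸ a)) ≤
      m * Module.length R (R ⧸ a) := fun n => by
    obtain ⟨φ, hφs, -⟩ := hφ n
    exact length_tensor_le_of_span _ φ hφs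
  have h1 : BoundedDifference
      (fun n => Module.length R ((R ⧸ a) →ₗ[R] (R ⧸ frobPower p (J ⊔ Ideal.span {x}) n))) κ := by
    -- Self-injectivity holds only for large `n`; finiteness is proved for every `n`.
    refine .of_eventually (fun n => ne_top_of_le_ne_top (length_quotient_ne_top ?_)
      (length_hom_quotient_le _ _)) hκ (hmul m) (hJGor.mono fun n hn => ?_)
    · rw [radical_frobPower, hI]
    · obtain ⟨hart, hloc, -, hinj⟩ := hn
      rw [frobPower_sup_span_singleton, length_hom_quotient_sup_span
        (baer_self_of_injectiveDimension_ne_top hinj)]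
      obtain ⟨h, h'⟩ := length_torsionBy_tensor_le (R ⧸ a) (frobPower p J n) (x ^ p ^ n)
      exact ⟨h.trans le_self_add, h'.trans (by rw [add_comm]; exact add_le_add_right (hJN n) _)⟩
  have h2 : BoundedDifference (fun n => Module.length R
        (frobTor R p n 1 (R ⧸ J ⊔ Ideal.span {x}) ⊗[R] (R ⧸ a))) κ :=
    .of_eventually (fun n => ne_top_of_le_ne_top (hκ n) (hc n).1) hκ (hmul c)
      (.of_forall fun n => ⟨(hc n).1.trans le_self_add, (hc n).2.trans (add_comm _ _).le⟩)
  have h3 : BoundedDifference (fun n => Module.length R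
        (torModule R 2 (R ⧸ frobPower p (J ⊔ Ideal.span {x}) n) (R ⧸ a))) κ := by
    -- The three summands of the constant bound `Tor_1(J^[q], R/a)`, `J^[q] ⊗ R/a` and `R/a`.
    refine .of_eventually (fun n => length_torModule_two_quotient_ne_top _ hN _) hκ
      (hadd (hadd (hmul l) (hmul m)) hN) (.of_forall fun n => ?_)
    rw [frobPower_sup_span_singleton]
    obtain ⟨φ, hφs, hφe⟩ := hφ n
    constructor
    · refine (length_torModule_two_sup_le _ _ _).trans ?_
      rw [add_comm, add_assoc]
      exact add_le_add_right
        ((length_torModule_one_le_of_presentation _ hφe hφs).trans le_self_add) _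
    · refine (length_colon_tensor_le _ _ _).trans ?_
      rw [add_assoc]
      exact add_le_add_right (add_le_add_left ((hJN n).trans le_add_self) _) _
  exact ⟨h1.trans h2.symm, h2.trans h3.symm⟩

end Main

end

theorem theorem6p1 {R : Type u} [CommRing R] [IsLocalRing R] [IsNoetherianRing R]
    (p : ℕ) [Fact p.Prime] [CharP R p]
    (I J a : Ideal R) (x : R)
    (hI : I.IsPrimary ∧ I.radical = IsLocalRing.maximalIdeal R)
    (ha : a.IsPrimary ∧ a.radical = IsLocalRing.maximalIdeal R)
    (hIJ : I = J ⊔ Ideal.span {x})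
    (hJpd : projectiveDimension (ModuleCat.of R J) ≠ ⊤)
    (hJGor : ∀ᶠ n in Filter.atTop,
      IsArtinianRing (R ⧸ frobPower p J n) ∧ IsGorensteinLocal (R ⧸ frobPower p J n)) :
    BoundedDifference
      (fun n => Module.length R ((R ⧸ a) →ₗ[R] (R ⧸ frobPower p I n)))
      (fun n => Module.length R (frobTor R p n 1 (R ⧸ I) ⊗[R] (R ⧸ a))) ∧
    BoundedDifference
      (fun n => Module.length R (frobTor R p n 1 (R ⧸ I) ⊗[R] (R ⧸ a)))
      (fun n => Module.length R (torModule R 2 (R ⧸ frobPower p I n) (R ⧸ a))) ∧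
    BoundedDifference
      (fun n => Module.length R ((R ⧸ a) →ₗ[R] (R ⧸ frobPower p I n)))
      (fun n => Module.length R (torModule R 2 (R ⧸ frobPower p I n) (R ⧸ a))) ∧
    BoundedDifference
      (fun n => Module.length R (socle R (R ⧸ frobPower p I n)))
      (fun n => (bettiNumber R (R ⧸ frobPower p I n) 2 : ℕ∞)) := by
  subst hIJ
  obtain ⟨h1, h2⟩ := boundedDifference_hom_frobTor_torModule p J a x hI.2 ha.2 hJpd hJGor
  -- The socle and Betti statement is the case where `a` is the maximal ideal.
  obtain ⟨h3, h4⟩ := boundedDifference_hom_frobTor_torModule p J (IsLocalRing.maximalIdeal R) x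
    hI.2 (Ideal.IsPrime.radical inferInstance) hJpd hJGor
  refine ⟨h1, h2, h1.trans h2, ?_⟩
  simp only [length_socle, bettiNumber_two_eq_length]
  exact h3.trans h4
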